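/- Let $\mathcal C$ be a (small) symmetric tensor category over $\mathbb C$, i.e. a $\mathbb C$-linear abelian rigid symmetric monoidal category with $\mathbb C$-bilinear tensor product, in which all objects have finite length, all morphism spaces are finite dimensional, and $\mathrm{End}(\mathbf 1)=\mathbb C$. Let $\mathrm{Ind}\,\mathcal C$ be its ind-completion, with the induced symmetric monoidal structure. Let $G$ be an affine group scheme in $\mathcal C$, i.e. let $H=O(G)$ be a commutative Hopf algebra in $\mathrm{Ind}\,\mathcal C$ with coproduct $\Delta$, counit $\varepsilon$ and augmentation ideal $I=\mathrm{Ker}\,\varepsilon$. The object $I/I^2$ is a Lie coalgebra, with cobracket induced by $x\mapsto x_{(1)}\otimes x_{(2)}-x_{(2)}\otimes x_{(1)}$, and its dual $\mathfrak g=(I/I^2)^*$ (in general a pro-object) is the Lie algebra of $G$; thus a $\mathfrak g$-action on an object $M$ of $\mathrm{Ind}\,\mathcal C$ is a morphism $M\to I/I^2\otimes M$ compatible with the cobracket. For a left $H$-comodule $(M,\rho)$ in $\mathrm{Ind}\,\mathcal C$ let $$\zeta_M: M\to I/I^2\otimes M,\qquad \zeta_M(x)=\rho(x)-1\otimes x \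 \text{ modulo } I^2 \text{ in the first factor};$$ this is a $\mathfrak g$-action on $M$. Say that $G$ is connected if $H^{\mathfrak g}:=\mathrm{Ker}(\zeta_H)$, for the coaction $\rho=\Delta$ of $H$ on itself, is isomorphic to $\mathbf 1$. Let $\mathbf{Rep}(G)$ be the category of left $H$-comodules whose underlying object lies in $\mathcal C$, let $\mathbf{Rep}(\mathfrak g)$ be the category of $\mathfrak g$-modules whose underlying object lies in $\mathcal C$, and let $D:\mathrm{Ind}\,\mathbf{Rep}(G)\to\mathrm{Ind}\,\mathbf{Rep}(\mathfrak g)$ be the derivative functor, i.e. the functor on ind-completions induced by $M\mapsto (M,\zeta_M)$. Then $G$ is connected if and only if $D$ is fully faithful. Likewise, $G$ is connected if and only if the functor $M\mapsto (M,\zeta_M)$ from the category of all left $H$-comodules in $\mathrm{Ind}\,\mathcal C$ (locally algebraic $G$-modules) to the category of all $\mathfrak g$-modules in $\mathrm{Ind}\,\mathcal C$ is fully faithful. -/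

import Mathlib

open CategoryTheory Limits MonoidalCategory
open scoped MonoidalCategory.ExternalProduct

universe w v u v₁ u₁ v₂ u₂ v₃ u₃

noncomputable section

/-! ### Ind-objects: the symmetric monoidal structure on `Ind C`

`Ind C` is a full subcategory of presheaves on `C`. The tensor product of ind-objects is their
Day convolution, the extension of the tensor product of `C` that commutes with filtered colimits
in each variable. -/

namespace IndTensor

section braided
open LawfulDayConvolutionMonoidalCategoryStruct
attribute [local instance] convolution convolution₂ convolution₂'

section general
variable {C : Type u₁} [Category.{v₁} C] [MonoidalCategory C]
  {V : Type u₂} [Category.{v₂} V] [MonoidalCategory V]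
  {D : Type u₃} [Category.{v₃} D] [MonoidalCategory D]
  [LawfulDayConvolutionMonoidalCategoryStruct C V D]

lemma ι_map_whiskerRight {X X' : D} (f : X ⟶ X') (Y : D) :
    (ι C V D).map (f ▷ Y) = DayConvolution.map ((ι C V D).map f) (𝟙 ((ι C V D).obj Y)) := by
  rw [← tensorHom_id, ι_map_tensorHom_hom_eq_tensorHom, CategoryTheory.Functor.map_id]

lemma ι_map_whiskerLeft {X X' : D} (f : X ⟶ X') (Y : D) :
    (ι C V D).map (Y ◁ f) = DayConvolution.map (𝟙 ((ι C V D).obj Y)) ((ι C V D).map f) := by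
  rw [← id_tensorHom, ι_map_tensorHom_hom_eq_tensorHom, CategoryTheory.Functor.map_id]

variable [∀ (v : V) (d : C), Limits.PreservesColimitsOfShape
      (CostructuredArrow (tensor C) d) (tensorLeft v)]
    [∀ (v : V) (d : C), Limits.PreservesColimitsOfShape
      (CostructuredArrow (tensor C) d) (tensorRight v)]

lemma ι_map_associator_inv (X Y Z : D) :
    (ι C V D).map (α_ X Y Z).inv =
    (DayConvolution.associator
      ((ι C V D).obj X) ((ι C V D).obj Y) ((ι C V D).obj Z)).inv := by
  rw [← cancel_mono (DayConvolution.associator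
      ((ι C V D).obj X) ((ι C V D).obj Y) ((ι C V D).obj Z)).hom, Iso.inv_hom_id,
    ← ι_map_associator_hom_eq_associator_hom]
  rw [← Functor.map_comp, Iso.inv_hom_id, CategoryTheory.Functor.map_id]

end general

variable {C : Type u₁} [Category.{v₁} C] [MonoidalCategory C] [SymmetricCategory C]
  {V : Type u₂} [Category.{v₂} V] [MonoidalCategory V] [SymmetricCategory V]
  {D : Type u₃} [Category.{v₃} D] [MonoidalCategory D]
  [LawfulDayConvolutionMonoidalCategoryStruct C V D]

/-- The braiding on a full subcategory of functors closed under Day convolution. -/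
def dayBraiding (hι : (ι C V D).FullyFaithful) (X Y : D) : X ⊗ Y ≅ Y ⊗ X :=
  hι.preimageIso (DayConvolution.braiding ((ι C V D).obj X) ((ι C V D).obj Y))

lemma ι_map_dayBraiding (hι : (ι C V D).FullyFaithful) (X Y : D) :
    (ι C V D).map (dayBraiding hι X Y).hom =
      (DayConvolution.braiding ((ι C V D).obj X) ((ι C V D).obj Y)).hom := by
  simp [dayBraiding]

variable [∀ (v : V) (d : C), Limits.PreservesColimitsOfShape
      (CostructuredArrow (tensor C) d) (tensorLeft v)]
    [∀ (v : V) (d : C), Limits.PreservesColimitsOfShape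
      (CostructuredArrow (tensor C) d) (tensorRight v)]

/-- The symmetric monoidal structure on a full subcategory of functors closed under Day
convolution. -/
@[reducible]
def daySymmetricCategory (hι : (ι C V D).FullyFaithful) : SymmetricCategory D where
  braiding X Y := dayBraiding hι X Y
  braiding_naturality_right X Y Z f := by
    apply (ι C V D).map_injective
    simp only [Functor.map_comp, ι_map_whiskerRight, ι_map_whiskerLeft, ι_map_dayBraiding]
    exact DayConvolution.braiding_naturality_right _ _
  braiding_naturality_left f Z := by
    apply (ι C V D).map_injective
    simp only [Functor.map_comp, ι_map_whiskerRight, ι_map_whiskerLeft, ι_map_dayBraiding]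
    exact DayConvolution.braiding_naturality_left _ _
  hexagon_forward X Y Z := by
    apply (ι C V D).map_injective
    simp only [Functor.map_comp, ι_map_whiskerRight, ι_map_whiskerLeft, ι_map_dayBraiding,
      ι_map_associator_hom_eq_associator_hom]
    exact DayConvolution.hexagon_forward _ _ _
  hexagon_reverse X Y Z := by
    apply (ι C V D).map_injective
    simp only [Functor.map_comp, ι_map_whiskerRight, ι_map_whiskerLeft, ι_map_dayBraiding,
      ι_map_associator_inv]
    exact DayConvolution.hexagon_reverse _ _ _
  symmetry X Y := by
    apply (ι C V D).map_injective
    simp only [Functor.map_comp, ι_map_dayBraiding, CategoryTheory.Functor.map_id]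
    exact DayConvolution.symmetry _ _
end braided

section general
variable {C : Type v} [SmallCategory C] {C' : Type v} [SmallCategory C']

lemma isIndObject_of_preserves (T : (Cᵒᵖ ⥤ Type v) ⥤ (C'ᵒᵖ ⥤ Type v))
    [PreservesColimitsOfSize.{v, v} T] (h : ∀ X, IsIndObject (T.obj (yoneda.obj X)))
    {A : Cᵒᵖ ⥤ Type v} (hA : IsIndObject A) : IsIndObject (T.obj A) := by
  have P := hA.presentation
  have e : T.obj A ≅ colimit ((P.F ⋙ yoneda) ⋙ T) :=
    (isColimitOfPreserves T P.coconeIsColimit).coconePointUniqueUpToIso (colimit.isColimit _)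
  refine IsIndObject.map e.inv (isIndObject_colimit _ _ fun i => h _)

lemma essImage_of_isIndObject {A : Cᵒᵖ ⥤ Type v} (hA : IsIndObject A) :
    (Ind.inclusion C).essImage A :=
  ⟨(Ind.equivalence C).inverse.obj ⟨A, hA⟩,
    ⟨(ObjectProperty.ι _).mapIso ((Ind.equivalence C).counitIso.app ⟨A, hA⟩)⟩⟩

lemma isIndObject_lan_op (F : C ⥤ C') {A : Cᵒᵖ ⥤ Type v} (hA : IsIndObject A) :
    IsIndObject (F.op.lan.obj A) := by
  have : PreservesColimitsOfSize.{v, v} (F.op.lan : (Cᵒᵖ ⥤ Type v) ⥤ (C'ᵒᵖ ⥤ Type v)) :=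
    (F.op.lanAdjunction (Type v)).leftAdjoint_preservesColimits
  exact isIndObject_of_preserves F.op.lan (fun X => (isIndObject_yoneda (F.obj X)).map
    (Functor.leftKanExtensionUnique _ (yonedaMap F X) _ (F.op.lanUnit.app _)).hom) hA

/-- The functor `Ind F : Ind C ⥤ Ind C'` induced by `F : C ⥤ C'`, sending a formal filtered colimit
of objects `X` to the formal filtered colimit of the objects `F X`. On presheaves it is the left
Kan extension along `F`. -/
def indMap (F : C ⥤ C') : Ind C ⥤ Ind C' :=
  ObjectProperty.lift _ (Ind.inclusion C ⋙ F.op.lan)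
    (fun X => isIndObject_lan_op F X.isIndObject_inclusion_obj) ⋙ (Ind.equivalence C').inverse

end general

section day
variable {C : Type v} [SmallCategory C] [MonoidalCategory C]

instance preservesColimits_sectL (B : Cᵒᵖ ⥤ Type v) (J : Type v) [SmallCategory J] :
    PreservesColimitsOfShape J
      (Prod.sectL (Cᵒᵖ ⥤ Type v) B ⋙ externalProductBifunctor Cᵒᵖ Cᵒᵖ (Type v)) := by
  apply preservesColimitsOfShape_of_evaluation
  rintro ⟨x, y⟩
  refine preservesColimitsOfShape_of_natIso
    (F := (evaluation Cᵒᵖ (Type v)).obj x ⋙ tensorRight (B.obj y)) ?_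
  exact NatIso.ofComponents (fun A => Iso.refl _) (fun f => by ext; rfl)

instance preservesColimits_sectR (A : Cᵒᵖ ⥤ Type v) (J : Type v) [SmallCategory J] :
    PreservesColimitsOfShape J
      (Prod.sectR A (Cᵒᵖ ⥤ Type v) ⋙ externalProductBifunctor Cᵒᵖ Cᵒᵖ (Type v)) := by
  apply preservesColimitsOfShape_of_evaluation
  rintro ⟨x, y⟩
  refine preservesColimitsOfShape_of_natIso
    (F := (evaluation Cᵒᵖ (Type v)).obj y ⋙ tensorLeft (A.obj x)) ?_
  exact NatIso.ofComponents (fun A => Iso.refl _) (fun f => by ext; rfl)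

/-- The tensor product of morphisms of `C`, as a map from the external product of two
representable presheaves. -/
def yonedaTensorMap (X Y : C) :
    yoneda.obj X ⊠ yoneda.obj Y ⟶ tensor Cᵒᵖ ⋙ yoneda.obj (X ⊗ Y) where
  app p := ↾fun q => q.1 ⊗ₘ q.2
  naturality p q f := by
    ext ⟨a, b⟩
    change (f.1.unop ≫ a) ⊗ₘ (f.2.unop ≫ b) = (f.1.unop ⊗ₘ f.2.unop) ≫ (a ⊗ₘ b)
    simp

instance (X Y : C) (E : (tensor Cᵒᵖ).LeftExtension (yoneda.obj X ⊠ yoneda.obj Y)) :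
    Unique (Functor.LeftExtension.mk _ (yonedaTensorMap X Y) ⟶ E) where
  default := StructuredArrow.homMk
      (yonedaEquiv.symm (E.hom.app (.op X, .op Y) ((𝟙 X, 𝟙 Y) : (X ⟶ X) × (Y ⟶ Y)))) (by
        ext ⟨a, b⟩ ⟨f, g⟩
        have := ConcreteCategory.congr_hom
          (E.hom.naturality (X := (.op X, .op Y)) (Y := (a, b)) (Prod.mkHom f.op g.op))
            ((𝟙 X, 𝟙 Y) : (X ⟶ X) × (Y ⟶ Y))
        refine this.symm.trans ?_
        change E.hom.app (a, b) (f ≫ 𝟙 X, g ≫ 𝟙 Y) = E.hom.app (a, b) (f, g)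
        simp)
  uniq φ := by
    ext1
    apply yonedaEquiv.injective
    refine Eq.trans ?_ (Equiv.apply_symm_apply yonedaEquiv _).symm
    rw [← StructuredArrow.w φ]
    change φ.right.app (.op (X ⊗ Y)) (𝟙 (X ⊗ Y)) = φ.right.app (.op (X ⊗ Y)) (𝟙 X ⊗ₘ 𝟙 Y)
    simp

instance (X Y : C) :
    (yoneda.obj (X ⊗ Y)).IsLeftKanExtension (yonedaTensorMap X Y) :=
  ⟨⟨Limits.IsInitial.ofUnique _⟩⟩

lemma isIndObject_lan_yoneda (X Y : C) :
    IsIndObject ((tensor Cᵒᵖ).lan.obj (yoneda.obj X ⊠ yoneda.obj Y)) :=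
  (isIndObject_yoneda (X ⊗ Y)).map (Functor.leftKanExtensionUnique _ (yonedaTensorMap X Y) _
    ((tensor Cᵒᵖ).lanUnit.app _)).hom

lemma isIndObject_lan {A B : Cᵒᵖ ⥤ Type v} (hA : IsIndObject A) (hB : IsIndObject B) :
    IsIndObject ((tensor Cᵒᵖ).lan.obj (A ⊠ B)) := by
  have : PreservesColimitsOfSize.{v, v} ((tensor Cᵒᵖ).lan :
      (Cᵒᵖ × Cᵒᵖ ⥤ Type v) ⥤ (Cᵒᵖ ⥤ Type v)) :=
    ((tensor Cᵒᵖ).lanAdjunction (Type v)).leftAdjoint_preservesColimits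
  have (B : Cᵒᵖ ⥤ Type v) : PreservesColimitsOfSize.{v, v} (Prod.sectL (Cᵒᵖ ⥤ Type v) B ⋙
      externalProductBifunctor Cᵒᵖ Cᵒᵖ (Type v)) := ⟨inferInstance⟩
  have (A : Cᵒᵖ ⥤ Type v) : PreservesColimitsOfSize.{v, v} (Prod.sectR A (Cᵒᵖ ⥤ Type v) ⋙
      externalProductBifunctor Cᵒᵖ Cᵒᵖ (Type v)) := ⟨inferInstance⟩
  exact isIndObject_of_preserves ((Prod.sectL (Cᵒᵖ ⥤ Type v) B ⋙
    externalProductBifunctor Cᵒᵖ Cᵒᵖ (Type v)) ⋙ (tensor Cᵒᵖ).lan)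
    (fun X => isIndObject_of_preserves ((Prod.sectR (yoneda.obj X) (Cᵒᵖ ⥤ Type v) ⋙
      externalProductBifunctor Cᵒᵖ Cᵒᵖ (Type v)) ⋙ (tensor Cᵒᵖ).lan)
      (fun Y => isIndObject_lan_yoneda X Y) hB) hA


/-- The identity of the unit of `C`, as an element of the presheaf it represents. -/
def yonedaUnitMap : Functor.fromPUnit.{0} (𝟙_ (Type v)) ⟶
    Functor.fromPUnit.{0} (𝟙_ Cᵒᵖ) ⋙ yoneda.obj (𝟙_ C) where
  app _ := ↾fun _ => 𝟙 (𝟙_ C)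

instance (E : (Functor.fromPUnit.{0} (𝟙_ Cᵒᵖ)).LeftExtension
      (Functor.fromPUnit.{0} (𝟙_ (Type v)))) :
    Unique (Functor.LeftExtension.mk _ (yonedaUnitMap (C := C)) ⟶ E) where
  default := StructuredArrow.homMk
      (yonedaEquiv.symm (E.hom.app ⟨⟨⟩⟩ PUnit.unit)) (by
        ext a b
        change E.right.map (𝟙 (𝟙_ C)).op _ = _
        simp
        rfl)
  uniq φ := by
    ext1
    apply yonedaEquiv.injective
    refine Eq.trans ?_ (Equiv.apply_symm_apply yonedaEquiv _).symm
    rw [← StructuredArrow.w φ]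
    rfl

instance : (yoneda.obj (𝟙_ C)).IsLeftKanExtension (yonedaUnitMap (C := C)) :=
  ⟨⟨Limits.IsInitial.ofUnique _⟩⟩

lemma essImage_tensor (X Y : Ind C) : (Ind.inclusion C).essImage
    ((tensor Cᵒᵖ).pointwiseLeftKanExtension
      ((Ind.inclusion C).obj X ⊠ (Ind.inclusion C).obj Y)) := by
  refine essImage_of_isIndObject ((isIndObject_lan X.isIndObject_inclusion_obj
    Y.isIndObject_inclusion_obj).map (Functor.leftKanExtensionUnique _
      ((tensor Cᵒᵖ).lanUnit.app _) _ ((tensor Cᵒᵖ).pointwiseLeftKanExtensionUnit _)).hom)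

lemma essImage_unit : (Ind.inclusion C).essImage
    ((Functor.fromPUnit.{0} (𝟙_ Cᵒᵖ)).pointwiseLeftKanExtension
      (Functor.fromPUnit.{0} (𝟙_ (Type v)))) :=
  essImage_of_isIndObject ((isIndObject_yoneda (𝟙_ C)).map (Functor.leftKanExtensionUnique _
    (yonedaUnitMap (C := C)) _ (Functor.pointwiseLeftKanExtensionUnit _ _)).hom)

instance : MonoidalCategory (Ind C) :=
  monoidalOfHasDayConvolutions (Ind.inclusion C) Ind.inclusion.fullyFaithful
    essImage_tensor essImage_unit

instance : LawfulDayConvolutionMonoidalCategoryStruct Cᵒᵖ (Type v) (Ind C) :=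
  lawfulDayConvolutionMonoidalCategoryStructOfHasDayConvolutions
    (Ind.inclusion C) Ind.inclusion.fullyFaithful essImage_tensor essImage_unit

lemma day_ι : LawfulDayConvolutionMonoidalCategoryStruct.ι Cᵒᵖ (Type v) (Ind C) = Ind.inclusion C := rfl


instance [SymmetricCategory C] : SymmetricCategory Cᵒᵖ where
  symmetry X Y := Quiver.Hom.unop_inj (by simp)

instance [SymmetricCategory C] : SymmetricCategory (Ind C) :=
  daySymmetricCategory (C := Cᵒᵖ) (V := Type v) Ind.inclusion.fullyFaithful
end day

section preadditive

variable {C : Type v} [SmallCategory C]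

/-- Morphisms `X ⟶ W` in `Ind C` with `X` in `C` are the elements of the presheaf `W` at `X`. -/
def homElt (X : C) (W : Ind C) :
    (Ind.yoneda.obj X ⟶ W) ≃ ((Ind.inclusion C).obj W).obj (.op X) :=
  Ind.inclusion.fullyFaithful.homEquiv.trans
    (((Ind.yonedaCompInclusion.app X).homCongr (Iso.refl _)).trans yonedaEquiv)

lemma homElt_comp {X : C} {W W' : Ind C} (w : Ind.yoneda.obj X ⟶ W) (φ : W ⟶ W') :
    homElt X W' (w ≫ φ) = ((Ind.inclusion C).map φ).app _ (homElt X W w) := by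
  simp [homElt, yonedaEquiv, Functor.FullyFaithful.homEquiv]

lemma homElt_yoneda_comp {X X' : C} (f : X' ⟶ X) {W : Ind C} (w : Ind.yoneda.obj X ⟶ W) :
    homElt X' W (Ind.yoneda.map f ≫ w) = ((Ind.inclusion C).obj W).map f.op (homElt X W w) := by
  have := (Ind.yonedaCompInclusion (C := C)).inv.naturality f
  simp only [Functor.comp_map] at this
  simp only [homElt, Equiv.trans_apply, Functor.FullyFaithful.homEquiv_apply, Iso.homCongr_apply, Functor.map_comp]
  simp only [Iso.refl_hom, Category.comp_id]
  erw [← reassoc_of% this]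
  rw [← yonedaEquiv_naturality]
  rfl

/-- Any two morphisms from an object of `C` to an ind-object factor through a common object
of `C`. -/
lemma exists_factor {X : C} {W : Ind C} (f g : Ind.yoneda.obj X ⟶ W) :
    ∃ (Y : C) (p q : X ⟶ Y) (y : Ind.yoneda.obj Y ⟶ W),
      f = Ind.yoneda.map p ≫ y ∧ g = Ind.yoneda.map q ≫ y := by
  have : IsFiltered (CostructuredArrow Ind.yoneda W) := RepresentablyCoflat.filtered W
  let F : CostructuredArrow Ind.yoneda W := .mk f
  let G : CostructuredArrow Ind.yoneda W := .mk g
  exact ⟨(IsFiltered.max F G).left, (IsFiltered.leftToMax F G).left,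
    (IsFiltered.rightToMax F G).left, (IsFiltered.max F G).hom,
    (CostructuredArrow.w (IsFiltered.leftToMax F G)).symm,
    (CostructuredArrow.w (IsFiltered.rightToMax F G)).symm⟩

section mon
variable [MonoidalCategory C]
open LawfulDayConvolutionMonoidalCategoryStruct

/-- The canonical morphism comparing the tensor products of `C` and `Ind C`. -/
def tensorComparison (X Y : C) : Ind.yoneda.obj (X ⊗ Y) ⟶ Ind.yoneda.obj X ⊗ Ind.yoneda.obj Y :=
  (homElt _ _).symm ((convolutionExtensionUnit Cᵒᵖ (Type v) (Ind.yoneda.obj X)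
    (Ind.yoneda.obj Y)).app (.op X, .op Y) ((homElt X _ (𝟙 _), homElt Y _ (𝟙 _)) : _ × _))

lemma homElt_tensorComparison {X Y : C} {W Z : Ind C} (w : Ind.yoneda.obj X ⟶ W)
    (z : Ind.yoneda.obj Y ⟶ Z) :
    homElt _ _ (tensorComparison X Y ≫ (w ⊗ₘ z)) =
      (convolutionExtensionUnit Cᵒᵖ (Type v) W Z).app (.op X, .op Y)
        ((homElt X _ w, homElt Y _ z) : _ × _) := by
  have h := ConcreteCategory.congr_hom
    (convolutionExtensionUnit_comp_ι_map_tensorHom_app Cᵒᵖ (Type v) w z (.op X) (.op Y))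
    ((homElt X _ (𝟙 _), homElt Y _ (𝟙 _)) : _ × _)
  rw [homElt_comp, tensorComparison, Equiv.apply_symm_apply]
  refine h.trans ?_
  have hw := homElt_comp (𝟙 (Ind.yoneda.obj X)) w
  have hz := homElt_comp (𝟙 (Ind.yoneda.obj Y)) z
  rw [Category.id_comp] at hw hz
  rw [hw, hz]
  rfl

lemma tensor_hom_ext {W Z U : Ind C} {φ ψ : W ⊗ Z ⟶ U}
    (h : ∀ (X Y : C) (w : Ind.yoneda.obj X ⟶ W) (z : Ind.yoneda.obj Y ⟶ Z),
      tensorComparison X Y ≫ (w ⊗ₘ z) ≫ φ = tensorComparison X Y ≫ (w ⊗ₘ z) ≫ ψ) : φ = ψ := by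
  have : ((ι Cᵒᵖ (Type v) (Ind C)).obj (W ⊗ Z)).IsLeftKanExtension
      (convolutionExtensionUnit Cᵒᵖ (Type v) W Z) :=
    (isPointwiseLeftKanExtensionConvolutionExtensionUnit (C := Cᵒᵖ) (V := Type v)
      W Z).isLeftKanExtension
  apply (ι Cᵒᵖ (Type v) (Ind C)).map_injective
  apply Functor.hom_ext_of_isLeftKanExtension _
    (convolutionExtensionUnit Cᵒᵖ (Type v) W Z)
  ext ⟨⟨X⟩, ⟨Y⟩⟩ ⟨a, b⟩
  obtain ⟨w, rfl⟩ := (homElt X W).surjective a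
  obtain ⟨z, rfl⟩ := (homElt Y Z).surjective b
  have h' := congrArg (homElt _ _) (h X Y w z)
  simp only [← Category.assoc] at h'
  rw [homElt_comp (tensorComparison X Y ≫ (w ⊗ₘ z)) φ,
    homElt_comp (tensorComparison X Y ≫ (w ⊗ₘ z)) ψ, homElt_tensorComparison] at h'
  exact h'

lemma yoneda_map_tensorHom {X X' Y Y' : C} (f : X ⟶ X') (g : Y ⟶ Y') :
    Ind.yoneda.map (f ⊗ₘ g) ≫ tensorComparison X' Y' =
      tensorComparison X Y ≫ (Ind.yoneda.map f ⊗ₘ Ind.yoneda.map g) := by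
  apply (homElt _ _).injective
  rw [homElt_tensorComparison, homElt_yoneda_comp, tensorComparison, Equiv.apply_symm_apply]
  have hf := homElt_yoneda_comp f (𝟙 _)
  have hg := homElt_yoneda_comp g (𝟙 _)
  rw [Category.comp_id] at hf hg
  rw [hf, hg]
  have := ConcreteCategory.congr_hom ((convolutionExtensionUnit Cᵒᵖ (Type v)
    (Ind.yoneda.obj X') (Ind.yoneda.obj Y')).naturality
      (X := (.op X', .op Y')) (Y := (.op X, .op Y)) (Prod.mkHom f.op g.op))
      ((homElt X' _ (𝟙 _), homElt Y' _ (𝟙 _)) : _ × _)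
  exact this.symm
end mon

section additive
variable [Abelian C]

instance : (Ind.yoneda (C := C)).Additive :=
  Functor.additive_of_preserves_binary_products _

variable [MonoidalCategory C] [MonoidalPreadditive C]

lemma ind_add_whiskerRight {X Y : Ind C} (Z : Ind C) (f g : X ⟶ Y) :
    (f + g) ▷ Z = f ▷ Z + g ▷ Z := by
  apply tensor_hom_ext
  intro A B x z
  obtain ⟨D, p, q, y, hf, hg⟩ := exists_factor (x ≫ f) (x ≫ g)
  have key (h : X ⟶ Y) (r : A ⟶ D) (hr : x ≫ h = Ind.yoneda.map r ≫ y) :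
      tensorComparison A B ≫ (x ⊗ₘ z) ≫ h ▷ Z =
        Ind.yoneda.map (r ▷ B) ≫ tensorComparison D B ≫ (y ⊗ₘ z) := by
    rw [← tensorHom_id, ← tensorHom_id, reassoc_of% yoneda_map_tensorHom r (𝟙 B),
      tensorHom_comp_tensorHom, tensorHom_comp_tensorHom, hr, CategoryTheory.Functor.map_id, Category.id_comp,
      Category.comp_id]
  have hfg : x ≫ (f + g) = Ind.yoneda.map (p + q) ≫ y := by
    rw [Preadditive.comp_add, hf, hg, Functor.map_add, Preadditive.add_comp]
  rw [key _ _ hfg, Preadditive.comp_add, Preadditive.comp_add, key _ _ hf, key _ _ hg,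
    MonoidalPreadditive.add_whiskerRight, Functor.map_add, Preadditive.add_comp]

lemma ind_whiskerLeft_add {X Y : Ind C} (Z : Ind C) (f g : X ⟶ Y) :
    Z ◁ (f + g) = Z ◁ f + Z ◁ g := by
  apply tensor_hom_ext
  intro A B z x
  obtain ⟨D, p, q, y, hf, hg⟩ := exists_factor (x ≫ f) (x ≫ g)
  have key (h : X ⟶ Y) (r : B ⟶ D) (hr : x ≫ h = Ind.yoneda.map r ≫ y) :
      tensorComparison A B ≫ (z ⊗ₘ x) ≫ Z ◁ h =
        Ind.yoneda.map (A ◁ r) ≫ tensorComparison A D ≫ (z ⊗ₘ y) := by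
    rw [← id_tensorHom, ← id_tensorHom, reassoc_of% yoneda_map_tensorHom (𝟙 A) r,
      tensorHom_comp_tensorHom, tensorHom_comp_tensorHom, hr, CategoryTheory.Functor.map_id, Category.id_comp,
      Category.comp_id]
  have hfg : x ≫ (f + g) = Ind.yoneda.map (p + q) ≫ y := by
    rw [Preadditive.comp_add, hf, hg, Functor.map_add, Preadditive.add_comp]
  rw [key _ _ hfg, Preadditive.comp_add, Preadditive.comp_add, key _ _ hf, key _ _ hg,
    MonoidalPreadditive.whiskerLeft_add, Functor.map_add, Preadditive.add_comp]

instance : MonoidalPreadditive (Ind C) where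
  whiskerLeft_zero {X Y Z} := by
    have := ind_whiskerLeft_add X (0 : Y ⟶ Z) 0
    rwa [add_zero, left_eq_add] at this
  zero_whiskerRight {X Y Z} := by
    have := ind_add_whiskerRight X (0 : Y ⟶ Z) 0
    rwa [add_zero, left_eq_add] at this
  whiskerLeft_add := ind_whiskerLeft_add _
  add_whiskerRight := ind_add_whiskerRight _
end additive
end preadditive

end IndTensor

/-! ### The Lie coalgebra of a Hopf algebra, comodules, and the derivative functor -/

namespace TensorLie
open scoped MonObj ComonObj

variable {A : Type u} [Category.{v} A] [MonoidalCategory A] [SymmetricCategory A]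

lemma tensorμ_inner (Q R : A) :
    ((ρ_ Q).inv ⊗ₘ (λ_ R).inv) ≫ tensorμ Q (𝟙_ A) (𝟙_ A) R ≫ ((ρ_ Q).hom ⊗ₘ (λ_ R).hom) =
      𝟙 (Q ⊗ R) := by
  simp only [tensorμ, braiding_tensorUnit_left]
  monoidal

lemma tensorμ_outer (Q R : A) :
    ((λ_ Q).inv ⊗ₘ (ρ_ R).inv) ≫ tensorμ (𝟙_ A) Q R (𝟙_ A) ≫ ((λ_ R).hom ⊗ₘ (ρ_ Q).hom) =
      (β_ Q R).hom := by
  simp only [tensorμ]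
  monoidal

variable [Abelian A] [MonoidalPreadditive A]

section Hopf

variable (H : A) [BimonObj H]

/-- The augmentation ideal `I` of `H`. -/
abbrev augIdeal : A := kernel ε[H]

/-- The multiplication `I ⊗ I ⟶ I`; its image is the square of `I`. -/
def augMul : augIdeal H ⊗ augIdeal H ⟶ augIdeal H :=
  kernel.lift ε[H] ((kernel.ι ε[H] ⊗ₘ kernel.ι ε[H]) ≫ μ[H]) (by
    rw [Category.assoc, BimonObj.mul_counit]
    change _ ≫ (ε[H] ⊗ₘ ε[H]) ≫ _ = 0
    rw [tensorHom_comp_tensorHom_assoc, kernel.condition, MonoidalPreadditive.zero_tensor, zero_comp])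

/-- The cotangent space `I / I²` at the identity, a Lie coalgebra under `cobracket` below. Its dual
is the Lie algebra `𝔤` of the group scheme with coordinate algebra `H`. -/
abbrev cotangent : A := cokernel (augMul H)

/-- The projection `x ↦ x - ε(x) 1` of `H` onto the augmentation ideal. -/
def toAug : H ⟶ augIdeal H :=
  kernel.lift ε[H] (𝟙 H - ε[H] ≫ η[H]) (by simp [Preadditive.sub_comp])

/-- The map `H ⟶ I / I²` sending `x` to the class of `x - ε(x) 1`. -/
def toCotangent : H ⟶ cotangent H := toAug H ≫ cokernel.π (augMul H)

set_option linter.unusedSectionVars false in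
lemma toAug_ι : toAug H ≫ kernel.ι ε[H] = 𝟙 H - ε[H] ≫ η[H] := by simp [toAug]

lemma augMul_ι : augMul H ≫ kernel.ι ε[H] = (kernel.ι ε[H] ⊗ₘ kernel.ι ε[H]) ≫ μ[H] := by
  simp [augMul]

lemma ι_toAug : kernel.ι ε[H] ≫ toAug H = 𝟙 _ := by
  rw [← cancel_mono (kernel.ι ε[H]), Category.assoc, toAug_ι]
  simp

lemma one_toCotangent : η[H] ≫ toCotangent H = 0 := by
  have : η[H] ≫ toAug H = 0 := by
    rw [← cancel_mono (kernel.ι ε[H]), Category.assoc, toAug_ι]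
    simp
  rw [toCotangent, reassoc_of% this, zero_comp]

lemma toAug_toAug : (toAug H ⊗ₘ toAug H) ≫ augMul H =
    μ[H] ≫ toAug H - (toAug H ⊗ₘ ε[H]) ≫ (ρ_ _).hom - (ε[H] ⊗ₘ toAug H) ≫ (λ_ _).hom := by
  rw [← cancel_mono (kernel.ι ε[H])]
  have e1 : ((toAug H ⊗ₘ ε[H]) ≫ (ρ_ _).hom) ≫ kernel.ι ε[H] =
      ((𝟙 H - ε[H] ≫ η[H]) ⊗ₘ (ε[H] ≫ η[H])) ≫ μ[H] := by
    rw [← toAug_ι, ← tensorHom_comp_tensorHom, Category.assoc, Category.assoc,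
      tensorHom_def' (kernel.ι ε[H]) η[H], Category.assoc, ← rightUnitor_naturality,
      whisker_exchange_assoc, MonObj.mul_one]
  have e2 : ((ε[H] ⊗ₘ toAug H) ≫ (λ_ _).hom) ≫ kernel.ι ε[H] =
      ((ε[H] ≫ η[H]) ⊗ₘ (𝟙 H - ε[H] ≫ η[H])) ≫ μ[H] := by
    rw [← toAug_ι, ← tensorHom_comp_tensorHom, Category.assoc, Category.assoc,
      tensorHom_def' η[H] (kernel.ι ε[H]), Category.assoc, ← leftUnitor_naturality,
      MonObj.one_mul]
  have e3 : (μ[H] ≫ toAug H) ≫ kernel.ι ε[H] =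
      (𝟙 _ - ((ε[H] ≫ η[H]) ⊗ₘ (ε[H] ≫ η[H]))) ≫ μ[H] := by
    have h1 : (η[H] ⊗ₘ η[H]) ≫ μ[H] = (λ_ (𝟙_ A)).hom ≫ η[H] := by
      rw [tensorHom_def', Category.assoc, MonObj.one_mul, leftUnitor_naturality]
    have h2 : μ[H] ≫ ε[H] = (ε[H] ⊗ₘ ε[H]) ≫ (λ_ (𝟙_ A)).hom := BimonObj.mul_counit H
    rw [Category.assoc, toAug_ι, Preadditive.sub_comp, Preadditive.comp_sub, Category.id_comp,
      Category.comp_id, ← tensorHom_comp_tensorHom, Category.assoc, h1, reassoc_of% h2]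
  have e4 : 𝟙 (H ⊗ H) = 𝟙 H ⊗ₘ 𝟙 H := by simp
  rw [Preadditive.sub_comp, Preadditive.sub_comp, e1, e2, e3, Category.assoc, augMul_ι,
    tensorHom_comp_tensorHom_assoc, toAug_ι, ← Preadditive.sub_comp, ← Preadditive.sub_comp]
  congr 1
  rw [e4]
  generalize ε[H] ≫ η[H] = e
  simp only [sub_eq_add_neg, MonoidalPreadditive.tensor_add, MonoidalPreadditive.add_tensor]
  have n1 (f g : H ⟶ H) : f ⊗ₘ (-g) = -(f ⊗ₘ g) := by
    rw [eq_neg_iff_add_eq_zero, ← MonoidalPreadditive.tensor_add]; simp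
  have n2 (f g : H ⟶ H) : (-f) ⊗ₘ g = -(f ⊗ₘ g) := by
    rw [eq_neg_iff_add_eq_zero, ← MonoidalPreadditive.add_tensor]; simp
  simp only [n1, n2]
  abel

/-- `toCotangent` is a derivation with respect to the counit. -/
lemma mul_toCotangent : μ[H] ≫ toCotangent H =
    (toCotangent H ⊗ₘ ε[H]) ≫ (ρ_ _).hom + (ε[H] ⊗ₘ toCotangent H) ≫ (λ_ _).hom := by
  have h := toAug_toAug H =≫ cokernel.π (augMul H)
  rw [Category.assoc, cokernel.condition, comp_zero, Preadditive.sub_comp, Preadditive.sub_comp,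
    eq_comm, sub_sub, sub_eq_zero] at h
  rw [toCotangent, ← Category.assoc, h]
  congr 1
  · rw [Category.assoc, ← rightUnitor_naturality, ← tensorHom_id, tensorHom_comp_tensorHom_assoc, Category.comp_id]
  · rw [Category.assoc, ← leftUnitor_naturality, ← id_tensorHom, tensorHom_comp_tensorHom_assoc, Category.comp_id]

/-- The map `(π ⊗ π) ∘ Δ`, where `π` is the projection to `I / I²`. -/
def comulCotangent : H ⟶ cotangent H ⊗ cotangent H :=
  Δ[H] ≫ (toCotangent H ⊗ₘ toCotangent H)

lemma one_comulCotangent : η[H] ≫ comulCotangent H = 0 := by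
  have h : η[H] ≫ Δ[H] = (λ_ (𝟙_ A)).inv ≫ (η[H] ⊗ₘ η[H]) := BimonObj.one_comul H
  rw [comulCotangent, reassoc_of% h, tensorHom_comp_tensorHom, one_toCotangent,
    MonoidalPreadditive.zero_tensor, comp_zero]

lemma aug_mul_comulCotangent :
    (kernel.ι ε[H] ⊗ₘ kernel.ι ε[H]) ≫ μ[H] ≫ comulCotangent H =
      (kernel.ι ε[H] ⊗ₘ kernel.ι ε[H]) ≫ (toCotangent H ⊗ₘ toCotangent H) ≫
        (𝟙 _ + (β_ (cotangent H) (cotangent H)).hom) := by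
  have c1 : Δ[H] ≫ (toCotangent H ⊗ₘ ε[H]) = toCotangent H ≫ (ρ_ _).inv := by
    rw [tensorHom_def', ComonObj.comul_counit_assoc, rightUnitor_inv_naturality]
  have c2 : Δ[H] ≫ (ε[H] ⊗ₘ toCotangent H) = toCotangent H ≫ (λ_ _).inv := by
    rw [MonoidalCategory.tensorHom_def, ComonObj.counit_comul_assoc, leftUnitor_inv_naturality]
  have c3 : Δ[H] ≫ (ε[H] ⊗ₘ ε[H]) = ε[H] ≫ (λ_ _).inv := by
    rw [MonoidalCategory.tensorHom_def, ComonObj.counit_comul_assoc, leftUnitor_inv_naturality]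
  have t {X X' Y Y' : A} (f : H ⟶ X) (f' : H ⟶ X') (g : H ⟶ Y) (g' : H ⟶ Y') :
      (Δ[H] ⊗ₘ Δ[H]) ≫ tensorμ H H H H ≫ ((f ⊗ₘ g) ⊗ₘ (f' ⊗ₘ g')) =
        ((Δ[H] ≫ (f ⊗ₘ f')) ⊗ₘ (Δ[H] ≫ (g ⊗ₘ g'))) ≫ tensorμ X X' Y Y' := by
    rw [← tensorμ_natural, tensorHom_comp_tensorHom_assoc]
  rw [comulCotangent, BimonObj.mul_comul_assoc, tensorHom_comp_tensorHom, mul_toCotangent]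
  simp only [MonoidalPreadditive.tensor_add, MonoidalPreadditive.add_tensor,
    Preadditive.comp_add, ← tensorHom_comp_tensorHom, reassoc_of% t, c1, c2, c3]
  have z1 {Y : A} (g : H ⟶ Y) : (kernel.ι ε[H] ⊗ₘ kernel.ι ε[H]) ≫ (g ⊗ₘ ε[H]) = 0 := by
    rw [tensorHom_comp_tensorHom, kernel.condition, MonoidalPreadditive.tensor_zero]
  have z2 {Y : A} (g : H ⟶ Y) : (kernel.ι ε[H] ⊗ₘ kernel.ι ε[H]) ≫ (ε[H] ⊗ₘ g) = 0 := by
    rw [tensorHom_comp_tensorHom, kernel.condition, MonoidalPreadditive.zero_tensor]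
  simp only [Category.assoc, tensorμ_inner, tensorμ_outer, reassoc_of% z1, reassoc_of% z2,
    zero_comp, zero_add, add_zero]
  exact add_comm _ _

/-- The Lie cobracket of the Lie coalgebra `I / I²`: it sends the class of `x` to the class of
`x₁ ⊗ x₂ - x₂ ⊗ x₁`. -/
def cobracket : cotangent H ⟶ cotangent H ⊗ cotangent H :=
  cokernel.desc (augMul H)
    (kernel.ι ε[H] ≫ comulCotangent H ≫ (𝟙 _ - (β_ (cotangent H) (cotangent H)).hom)) (by
      rw [← Category.assoc, augMul_ι, Category.assoc, reassoc_of% aug_mul_comulCotangent]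
      simp [Preadditive.add_comp, Preadditive.comp_sub, add_comm])

lemma toCotangent_cobracket : toCotangent H ≫ cobracket H =
    comulCotangent H ≫ (𝟙 _ - (β_ (cotangent H) (cotangent H)).hom) := by
  rw [toCotangent, cobracket, Category.assoc, cokernel.π_desc, ← Category.assoc, toAug_ι,
    Preadditive.sub_comp, Category.assoc, reassoc_of% one_comulCotangent, zero_comp, comp_zero,
    sub_zero, Category.id_comp]

end Hopf

section Modules

variable {𝒞 : Type w} [Category.{v} 𝒞] (y : 𝒞 ⥤ A)

/-- Left comodules over the coalgebra `H` whose underlying object is `y X` for an object `X`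
of `𝒞`. -/
structure Comod (H : A) [ComonObj H] where
  /-- the underlying object -/
  X : 𝒞
  /-- the coaction -/
  coact : y.obj X ⟶ H ⊗ y.obj X
  counit_coact : coact ≫ ε[H] ▷ y.obj X = (λ_ (y.obj X)).inv
  coassoc : coact ≫ Δ[H] ▷ y.obj X = coact ≫ H ◁ coact ≫ (α_ H H (y.obj X)).inv

/-- Morphisms of comodules: morphisms of the underlying objects that commute with the
coactions. -/
@[ext]
structure Comod.Hom {y : 𝒞 ⥤ A} {H : A} [ComonObj H] (M N : Comod y H) where
  /-- the underlying morphism -/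
  hom : M.X ⟶ N.X
  comm : y.map hom ≫ N.coact = M.coact ≫ H ◁ y.map hom

instance (H : A) [ComonObj H] : Category (Comod y H) where
  Hom := Comod.Hom
  id M := ⟨𝟙 M.X, by simp⟩
  comp f g := ⟨f.hom ≫ g.hom, by simp [g.comm, reassoc_of% f.comm]⟩

/-- Modules over the Lie algebra `𝔤 = Q*` dual to a Lie coalgebra `Q` with cobracket `δ`, with
underlying object `y X` for an object `X` of `𝒞`. As `Q` is an ind-object, `𝔤` is a pro-object, and
an action `𝔤 ⊗ M ⟶ M` is by definition a morphism `M ⟶ Q ⊗ M`; the axiom is the dual form of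
`[a, b] m = a (b m) - b (a m)`. -/
structure LieMod {Q : A} (δ : Q ⟶ Q ⊗ Q) where
  /-- the underlying object -/
  X : 𝒞
  /-- the action -/
  act : y.obj X ⟶ Q ⊗ y.obj X
  act_bracket : act ≫ δ ▷ y.obj X =
    act ≫ Q ◁ act ≫ (α_ Q Q (y.obj X)).inv ≫ (𝟙 (Q ⊗ Q) - (β_ Q Q).hom) ▷ y.obj X

/-- Morphisms of modules: morphisms of the underlying objects that commute with the actions. -/
@[ext]
structure LieMod.Hom {y : 𝒞 ⥤ A} {Q : A} {δ : Q ⟶ Q ⊗ Q} (M N : LieMod y δ) where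
  /-- the underlying morphism -/
  hom : M.X ⟶ N.X
  comm : y.map hom ≫ N.act = M.act ≫ Q ◁ y.map hom

instance {Q : A} (δ : Q ⟶ Q ⊗ Q) : Category (LieMod y δ) where
  Hom := LieMod.Hom
  id M := ⟨𝟙 M.X, by simp⟩
  comp f g := ⟨f.hom ≫ g.hom, by simp [g.comm, reassoc_of% f.comm]⟩

/-- The map `ζ_M : M ⟶ I / I² ⊗ M` of a comodule `M` with coaction `ρ`, that is `ρ(x) - 1 ⊗ x`
modulo `I²` in the first factor. -/
def zeta (H : A) [BimonObj H] {M : A} (ρ : M ⟶ H ⊗ M) : M ⟶ cotangent H ⊗ M :=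
  ρ ≫ toCotangent H ▷ M

/-- The derivative functor, sending a comodule `M` to the Lie algebra module `(M, ζ_M)`. -/
def derivative (H : A) [BimonObj H] : Comod y H ⥤ LieMod y (cobracket H) where
  obj M :=
    { X := M.X
      act := zeta H M.coact
      act_bracket := by
        rw [zeta, Category.assoc, ← comp_whiskerRight, toCotangent_cobracket, comulCotangent]
        simp only [comp_whiskerRight, Category.assoc, reassoc_of% M.coassoc]
        simp only [MonoidalCategory.whiskerLeft_comp, Category.assoc]
        rw [← whisker_exchange_assoc, ← whisker_exchange_assoc]
        rw [MonoidalCategory.tensorHom_def']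
        simp only [comp_whiskerRight, Category.assoc]
        monoidal }
  map f := ⟨f.hom, by
    change _ ≫ zeta H _ = zeta H _ ≫ _
    simp only [zeta, reassoc_of% f.comm, Category.assoc, whisker_exchange]⟩

end Modules

end TensorLie

/-! ### Affine group schemes in a symmetric tensor category -/

namespace TensorLie

/-- Symmetric tensor categories over `ℂ`: abelian rigid symmetric monoidal categories with
`ℂ`-bilinear tensor product in which all objects have finite length, all morphism spaces are finite
dimensional, and `End(𝟙) = ℂ`. -/
class SymmetricTensorCategory (C : Type u) [Category.{v} C] [Abelian C] [Linear ℂ C]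
    [MonoidalCategory C] [SymmetricCategory C] [RigidCategory C] : Prop
    extends MonoidalPreadditive C, MonoidalLinear ℂ C where
  artinian (X : C) : IsArtinianObject X
  noetherian (X : C) : IsNoetherianObject X
  finiteDimensional (X Y : C) : FiniteDimensional ℂ (X ⟶ Y)
  end_unit : Function.Bijective (fun c : ℂ => c • 𝟙 (𝟙_ C))

open scoped MonObj ComonObj

variable {C : Type v} [SmallCategory C] [Abelian C] [MonoidalCategory C] [SymmetricCategory C]
  [MonoidalPreadditive C]

section
variable (H : Ind C) [BimonObj H]

/-- The group scheme with coordinate algebra `H` is connected if the kernel of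
`ζ_H : H ⟶ I / I² ⊗ H`, for the coaction of `H` on itself by the coproduct, is isomorphic to `𝟙`. -/
def IsConnectedGroup : Prop := Nonempty (kernel (zeta H Δ[H]) ≅ 𝟙_ (Ind C))

/-- Representations in `C` of the group scheme with coordinate algebra `H`: the left `H`-comodules
whose underlying object is in `C`. -/
abbrev Rep := Comod (Ind.yoneda (C := C)) H

/-- Locally algebraic representations: all left `H`-comodules in `Ind C`. -/
abbrev LocAlgRep := Comod (𝟭 (Ind C)) H

/-- Representations in `C` of the Lie algebra `𝔤 = (I / I²)*`. -/
abbrev LieRep := LieMod (Ind.yoneda (C := C)) (cobracket H)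

/-- All modules in `Ind C` over the Lie algebra `𝔤 = (I / I²)*`. -/
abbrev IndLieRep := LieMod (𝟭 (Ind C)) (cobracket H)

/-- The derivative functor `D : Ind Rep(G) ⥤ Ind Rep(𝔤)`. -/
def indDerivative : Ind (Rep H) ⥤ Ind (LieRep H) := IndTensor.indMap (derivative Ind.yoneda H)

/-- The derivative functor on locally algebraic representations. -/
def locAlgDerivative : LocAlgRep H ⥤ IndLieRep H := derivative (𝟭 (Ind C)) H

end

end TensorLie

end

open CategoryTheory MonoidalCategory TensorLie

/-! ### Invariants of a Hopf algebra and morphisms of comodules -/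

namespace TensorLie
open scoped MonObj ComonObj HopfObj

section Braiding

variable {A : Type u} [Category.{v} A] [MonoidalCategory A] [SymmetricCategory A]

/-! Read a left comodule as a module on which $G$ acts on the right. For a morphism $f:M\to N$ of
underlying objects, consider the $G$-dependent map $x\mapsto f(xg^{-1})g$, that is `conjugate`, a
morphism $M\to H\otimes N$. If $f$ commutes with the $\mathfrak g$-actions, the derivative of this
map vanishes (`conjugate_zeta`): by the Leibniz rule it is a sum of two terms, one from $g^{-1}$ and
one from $g$, and they cancel. So the map lands in the kernel of $\zeta_H\otimes N$.

Tensoring in $\mathrm{Ind}\,\mathcal C$ is exact, so this kernel is $H^{\mathfrak g}\otimes N$. If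
$G$ is connected, $H^{\mathfrak g}$ consists of scalars, and the map is constant in $g$, equal to
its value $f$ at $g=1$. Substituting $xg$ for $x$ gives $f(x)g=f(xg)$: $f$ is a comodule morphism
(`comm_coact_of_comm_zeta`). This is fullness; faithfulness is automatic, since the derivative
functor does not change underlying morphisms.

Conversely, the inclusion of $H^{\mathfrak g}$ is a $\mathfrak g$-morphism from a trivial module to
the regular one. Fullness makes it a comodule morphism, and an $x$ with $\Delta x=1\otimes x$ equals
$\varepsilon(x)1$. For comodules in $\mathcal C$ the argument is run on objects of $\mathcal C$
mapping to $H^{\mathfrak g}$; local finiteness (`exists_comod_factor`) replaces $H$ by a subcomodule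
in $\mathcal C$.

Finally, a functor of small categories is fully faithful exactly when its ind-extension is
(`indMap_fullyFaithful_iff`), so $\mathrm{Ind}\,\mathbf{Rep}(G)$ need not be compared with the
category of all comodules. -/

lemma tensorμ_unit_third (Q R S : A) :
    (Q ⊗ R) ◁ (λ_ S).inv ≫ tensorμ Q R (𝟙_ A) S ≫ (ρ_ Q).hom ▷ (R ⊗ S) = (α_ Q R S).hom := by
  simp only [tensorμ, braiding_tensorUnit_right]
  monoidal

lemma tensorμ_unit_first (Q R S : A) :
    (λ_ R).inv ▷ (Q ⊗ S) ≫ tensorμ (𝟙_ A) R Q S ≫ (λ_ Q).hom ▷ (R ⊗ S) =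
      (α_ R Q S).inv ≫ (β_ R Q).hom ▷ S ≫ (α_ Q R S).hom := by
  simp only [tensorμ]
  monoidal

end Braiding

/-! ### Conjugation of a morphism by the group -/

section Conjugate

variable {A : Type u} [Category.{v} A] [MonoidalCategory A] [SymmetricCategory A]
  (H : A) [HopfObj H] {M N : A} (ρM : M ⟶ H ⊗ M) (ρN : N ⟶ H ⊗ N) (f : M ⟶ N)

/-- The conjugate `g ↦ g⁻¹ f g` of a morphism `f` between comodules, as a map `M ⟶ H ⊗ N`. -/
noncomputable def conjugate : M ⟶ H ⊗ N :=
  ρM ≫ (𝒮[H] ⊗ₘ (f ≫ ρN)) ≫ (α_ H H N).inv ≫ μ[H] ▷ N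

variable {ρM ρN f}

/-- Evaluation of $f(xg^{-1})g$ at $g=1$. -/
lemma conjugate_counit (hM : ρM ≫ ε[H] ▷ M = (λ_ M).inv) (hN : ρN ≫ ε[H] ▷ N = (λ_ N).inv) :
    conjugate H ρM ρN f ≫ ε[H] ▷ N = f ≫ (λ_ N).inv := by
  have hε : 𝒮[H] ≫ ε[H] = ε[H] := HopfObj.antipode_counit H
  have hμ : μ[H] ≫ ε[H] = (ε[H] ⊗ₘ ε[H]) ≫ (λ_ (𝟙_ A)).hom := BimonObj.mul_counit H
  have e1 : (α_ H H N).inv ≫ (ε[H] ⊗ₘ ε[H]) ▷ N = (ε[H] ⊗ₘ (ε[H] ▷ N)) ≫ (α_ _ _ N).inv := by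
    rw [← tensorHom_id, ← tensorHom_id, associator_inv_naturality]
  have e2 : ρM ≫ (ε[H] ⊗ₘ (f ≫ (λ_ N).inv)) = (λ_ _).inv ≫ (_ ◁ (f ≫ (λ_ N).inv)) := by
    rw [MonoidalCategory.tensorHom_def, reassoc_of% hM]
  simp only [conjugate, Category.assoc, ← comp_whiskerRight, hμ]
  rw [comp_whiskerRight, reassoc_of% e1, tensorHom_comp_tensorHom_assoc, hε, Category.assoc, hN,
    reassoc_of% e2]
  monoidal

/-- Substituting $xg$ for $x$ in $f(xg^{-1})g$ leaves $f(x)g$: after coassociativity, the factor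
$x_{(-2)}S(x_{(-1)})$ collapses by the antipode axiom. This recovers the coaction from the
conjugate. -/
lemma mul_conjugate (hM : ρM ≫ ε[H] ▷ M = (λ_ M).inv)
    (hM' : ρM ≫ Δ[H] ▷ M = ρM ≫ H ◁ ρM ≫ (α_ H H M).inv) :
    ρM ≫ H ◁ conjugate H ρM ρN f ≫ (α_ H H N).inv ≫ μ[H] ▷ N = f ≫ ρN := by
  have e : H ◁ conjugate H ρM ρN f ≫ (α_ H H N).inv ≫ μ[H] ▷ N =
      H ◁ ρM ≫ (α_ H H M).inv ≫ (H ◁ 𝒮[H] ≫ μ[H]) ▷ M ≫ H ◁ (f ≫ ρN) ≫ (α_ H H N).inv ≫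
        μ[H] ▷ N := by
    have a : (α_ H (H ⊗ H) N).inv ≫ (H ◁ μ[H] ≫ μ[H]) ▷ N =
        H ◁ (α_ H H N).hom ≫ (α_ _ _ _).inv ≫ μ[H] ▷ _ ≫ (α_ _ _ _).inv ≫ μ[H] ▷ N := by
      rw [MonObj.mul_assoc_flip]
      monoidal
    rw [comp_whiskerRight] at a
    rw [conjugate, comp_whiskerRight, Category.assoc, ← whisker_exchange_assoc,
      MonoidalCategory.tensorHom_def]
    simp only [MonoidalCategory.whiskerLeft_comp, Category.assoc,
      associator_inv_naturality_middle_assoc, a]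
    monoidal
  rw [e, ← reassoc_of% hM', ← comp_whiskerRight_assoc, HopfObj.antipode_right, comp_whiskerRight,
    Category.assoc, reassoc_of% hM, ← whisker_exchange_assoc, ← leftUnitor_inv_naturality_assoc]
  have u : (λ_ (H ⊗ N)).inv ≫ η[H] ▷ (H ⊗ N) ≫ (α_ H H N).inv ≫ μ[H] ▷ N =
      (λ_ (H ⊗ N)).inv ≫ (α_ _ _ _).inv ≫ (η[H] ▷ H ≫ μ[H]) ▷ N := by monoidal
  rw [u, MonObj.one_mul]
  monoidal

end Conjugate

variable {A : Type u} [Category.{v} A] [MonoidalCategory A] [SymmetricCategory A]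
  [Abelian A] [MonoidalPreadditive A]

/-! ### The derivation $\zeta_H$ and the antipode -/

section Bimonoid

variable (H : A) [BimonObj H]

lemma zeta_comul : zeta H Δ[H] = Δ[H] ≫ toCotangent H ▷ H := rfl

/-- The map `ζ_H` is a derivation. -/
lemma mul_zeta : μ[H] ≫ zeta H Δ[H] =
    zeta H Δ[H] ▷ H ≫ (α_ _ _ _).hom ≫ cotangent H ◁ μ[H] +
      H ◁ zeta H Δ[H] ≫ (α_ _ _ _).inv ≫ (β_ H (cotangent H)).hom ▷ H ≫ (α_ _ _ _).hom ≫
        cotangent H ◁ μ[H] := by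
  have t {X X' Y Y' : A} (f : H ⟶ X) (f' : H ⟶ X') (g : H ⟶ Y) (g' : H ⟶ Y') :
      (Δ[H] ⊗ₘ Δ[H]) ≫ tensorμ H H H H ≫ ((f ⊗ₘ g) ⊗ₘ (f' ⊗ₘ g')) =
        ((Δ[H] ≫ (f ⊗ₘ f')) ⊗ₘ (Δ[H] ≫ (g ⊗ₘ g'))) ≫ tensorμ X X' Y Y' := by
    rw [← tensorμ_natural, tensorHom_comp_tensorHom_assoc]
  have e : Δ[H] ≫ (ε[H] ⊗ₘ 𝟙 H) = (λ_ H).inv := by simp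
  have s (X Y : A) (f : H ⊗ H ⟶ X) (g : X ⟶ Y) :
      ((f ≫ g) ⊗ₘ μ[H]) = (f ⊗ₘ (𝟙 H ⊗ₘ 𝟙 H)) ≫ g ▷ (H ⊗ H) ≫ Y ◁ μ[H] := by
    rw [← MonoidalCategory.tensorHom_def, tensorHom_comp_tensorHom]; simp
  rw [zeta_comul, BimonObj.mul_comul_assoc, ← tensorHom_id (toCotangent H), tensorHom_comp_tensorHom,
    mul_toCotangent, Category.comp_id, MonoidalPreadditive.add_tensor, Preadditive.comp_add,
    Preadditive.comp_add, s, s, reassoc_of% t, reassoc_of% t, e]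
  congr 1
  -- The two summands of the derivation rule for `toCotangent` put $\varepsilon$ on one of the two
  -- coproducts; that coproduct then collapses by the counit axiom.
  · rw [MonoidalCategory.tensorHom_def]
    simp only [Category.assoc, ← tensorμ_unit_third]
  · rw [MonoidalCategory.tensorHom_def']
    simp only [Category.assoc]
    rw [reassoc_of% (tensorμ_unit_first (cotangent H) H H)]

lemma one_zeta : η[H] ≫ zeta H Δ[H] = 0 := by
  have h : η[H] ≫ Δ[H] = (λ_ (𝟙_ A)).inv ≫ (η[H] ⊗ₘ η[H]) := BimonObj.one_comul H
  rw [zeta_comul, reassoc_of% h, ← tensorHom_id, tensorHom_comp_tensorHom, one_toCotangent,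
    MonoidalPreadditive.zero_tensor, comp_zero]

end Bimonoid

section Unit

variable {A : Type u} [Category.{v} A] [MonoidalCategory A]

/-- Eckmann–Hilton argument. It lets an arbitrary isomorphism $H^{\mathfrak g}\cong\mathbf 1$ be
used, with no knowledge of the endomorphisms of the unit of $\mathrm{Ind}\,\mathcal C$. -/
lemma end_unit_comm (a b : 𝟙_ A ⟶ 𝟙_ A) : a ≫ b = b ≫ a := by
  have ha : (λ_ (𝟙_ A)).inv ≫ a ▷ 𝟙_ A = a ≫ (λ_ (𝟙_ A)).inv := by
    rw [unitors_inv_equal, rightUnitor_inv_naturality]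
  rw [← cancel_mono (λ_ (𝟙_ A)).inv, Category.assoc, leftUnitor_inv_naturality, ← reassoc_of% ha,
    ← whisker_exchange, ← leftUnitor_inv_naturality_assoc, ha, Category.assoc]

end Unit

section Neg

variable {A : Type u} [Category.{v} A] [MonoidalCategory A] [Preadditive A]
  [MonoidalPreadditive A]

lemma neg_whiskerRight {X Y : A} (f : X ⟶ Y) (Z : A) : (-f) ▷ Z = -(f ▷ Z) := by
  rw [eq_neg_iff_add_eq_zero, ← MonoidalPreadditive.add_whiskerRight]
  simp

end Neg

section Hopf

variable (H : A) [HopfObj H]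

/-- Inversion has derivative $-1$ at the identity: apply the derivation `toCotangent` to
$S(x_{(1)})x_{(2)}=\varepsilon(x)1$. -/
lemma antipode_toCotangent : 𝒮[H] ≫ toCotangent H = -toCotangent H := by
  have h := HopfObj.antipode_left H =≫ toCotangent H
  have hε : 𝒮[H] ≫ ε[H] = ε[H] := HopfObj.antipode_counit H
  have e1 : Δ[H] ≫ 𝒮[H] ▷ H ≫ (toCotangent H ⊗ₘ ε[H]) ≫ (ρ_ _).hom = 𝒮[H] ≫ toCotangent H := by
    rw [← tensorHom_id, tensorHom_comp_tensorHom_assoc, Category.id_comp, tensorHom_def',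
      Category.assoc, ComonObj.comul_counit_assoc, rightUnitor_naturality, Iso.inv_hom_id_assoc]
  have e2 : Δ[H] ≫ 𝒮[H] ▷ H ≫ (ε[H] ⊗ₘ toCotangent H) ≫ (λ_ _).hom = toCotangent H := by
    rw [← tensorHom_id, tensorHom_comp_tensorHom_assoc, Category.id_comp, hε,
      MonoidalCategory.tensorHom_def, Category.assoc, ComonObj.counit_comul_assoc,
      leftUnitor_naturality, Iso.inv_hom_id_assoc]
  rw [Category.assoc, Category.assoc, Category.assoc, mul_toCotangent, one_toCotangent, comp_zero,
    Preadditive.comp_add, Preadditive.comp_add, e1, e2] at h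
  exact eq_neg_of_add_eq_zero_left h

/-- The antipode reverses the coproduct, so it moves the differentiated factor from the first place
to the second, with the sign from `antipode_toCotangent`. -/
lemma antipode_zeta : 𝒮[H] ≫ zeta H Δ[H] =
    -(Δ[H] ≫ (𝒮[H] ⊗ₘ toCotangent H) ≫ (β_ H (cotangent H)).hom) := by
  have h : 𝒮[H] ≫ Δ[H] = Δ[H] ≫ (β_ _ _).hom ≫ (𝒮[H] ⊗ₘ 𝒮[H]) := HopfObj.antipode_comul H
  have n {X Y Z W : A} (f : X ⟶ Y) (g : Z ⟶ W) : f ⊗ₘ (-g) = -(f ⊗ₘ g) := by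
    rw [eq_neg_iff_add_eq_zero, ← MonoidalPreadditive.tensor_add]; simp
  rw [zeta_comul, reassoc_of% h, ← tensorHom_id, tensorHom_comp_tensorHom, antipode_toCotangent,
    Category.comp_id, ← BraidedCategory.braiding_naturality, n]
  simp

end Hopf

section Invariants

variable (H : A) [HopfObj H] {M N : A} {ρM : M ⟶ H ⊗ M} {ρN : N ⟶ H ⊗ N} {f : M ⟶ N}

/-- Leibniz rule for a product $g^{-1}\cdot g$: the term differentiating $g^{-1}$ is minus
$f\circ\zeta_M$ with the remaining conjugation around it, the term differentiating $g$ is the same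
with $\zeta_N\circ f$, and the two agree up to sign by the hypothesis on $f$. -/
lemma conjugate_zeta (hM : ρM ≫ Δ[H] ▷ M = ρM ≫ H ◁ ρM ≫ (α_ H H M).inv)
    (hN : ρN ≫ Δ[H] ▷ N = ρN ≫ H ◁ ρN ≫ (α_ H H N).inv)
    (hf : f ≫ zeta H ρN = zeta H ρM ≫ cotangent H ◁ f) :
    conjugate H ρM ρN f ≫ zeta H Δ[H] ▷ N = 0 := by
  have hN' : ρN ≫ zeta H Δ[H] ▷ N = zeta H ρN ≫ cotangent H ◁ ρN ≫ (α_ _ _ _).inv := by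
    rw [zeta_comul, comp_whiskerRight, reassoc_of% hN, zeta, Category.assoc,
      ← whisker_exchange_assoc]
    monoidal
  have s : (α_ H (cotangent H) N).inv ≫ ((𝒮[H] ▷ _ ≫ (β_ H (cotangent H)).hom) ⊗ₘ ρN) ≫
      (α_ _ _ _).inv ≫ (α_ _ _ _).hom ▷ N ≫ (cotangent H ◁ μ[H]) ▷ N =
      𝒮[H] ▷ _ ≫ H ◁ (cotangent H ◁ ρN ≫ (α_ _ _ _).inv) ≫ (α_ _ _ _).inv ≫
      ((α_ _ _ _).inv ≫ (β_ H (cotangent H)).hom ▷ H ≫ (α_ _ _ _).hom ≫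
        cotangent H ◁ μ[H]) ▷ N := by
    rw [tensorHom_def', ← whisker_exchange_assoc]
    monoidal
  -- The derivative falls on the antipode factor; coassociativity of $M$ turns it into $\zeta_M$.
  have t1 : ρM ≫ (𝒮[H] ⊗ₘ (f ≫ ρN)) ≫ (α_ H H N).inv ≫
      (zeta H Δ[H] ▷ H ≫ (α_ _ _ _).hom ≫ cotangent H ◁ μ[H]) ▷ N =
      -(ρM ≫ H ◁ (zeta H ρM ≫ cotangent H ◁ f) ≫ (α_ H (cotangent H) N).inv ≫
        ((𝒮[H] ▷ _ ≫ (β_ H (cotangent H)).hom) ⊗ₘ ρN) ≫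
      (α_ _ _ _).inv ≫ (α_ _ _ _).hom ▷ N ≫ (cotangent H ◁ μ[H]) ▷ N) := by
    have e : ρM ≫ 𝒮[H] ▷ M ≫ zeta H Δ[H] ▷ M = -(ρM ≫ H ◁ zeta H ρM ≫
        (α_ H (cotangent H) M).inv ≫ (𝒮[H] ▷ _ ≫ (β_ H (cotangent H)).hom) ▷ M) := by
      rw [← comp_whiskerRight, antipode_zeta, neg_whiskerRight, Preadditive.comp_neg,
        comp_whiskerRight, reassoc_of% hM, zeta, tensorHom_def']
      congr 1
      monoidal
    have e' : (α_ H H N).inv ≫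
        (zeta H Δ[H] ▷ H ≫ (α_ _ _ _).hom ≫ cotangent H ◁ μ[H]) ▷ N =
        zeta H Δ[H] ▷ (H ⊗ N) ≫ (α_ _ _ _).inv ≫ (α_ _ _ _).hom ▷ N ≫
          (cotangent H ◁ μ[H]) ▷ N := by monoidal
    rw [e', MonoidalCategory.tensorHom_def, Category.assoc, whisker_exchange_assoc, reassoc_of% e,
      Preadditive.neg_comp, MonoidalCategory.tensorHom_def]
    simp only [comp_whiskerRight, MonoidalCategory.whiskerLeft_comp, Category.assoc,
      associator_inv_naturality_right_assoc, whisker_exchange_assoc]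
  -- The derivative falls on the coaction of $N$; `hN'` turns it into $\zeta_N$, and `hf` moves it
  -- across $f$ to $\zeta_M$.
  have t2 : ρM ≫ (𝒮[H] ⊗ₘ (f ≫ ρN)) ≫ (α_ H H N).inv ≫ (H ◁ zeta H Δ[H] ≫ (α_ _ _ _).inv ≫
        (β_ H (cotangent H)).hom ▷ H ≫ (α_ _ _ _).hom ≫ cotangent H ◁ μ[H]) ▷ N =
      ρM ≫ H ◁ (zeta H ρM ≫ cotangent H ◁ f) ≫
      𝒮[H] ▷ _ ≫ H ◁ (cotangent H ◁ ρN ≫ (α_ _ _ _).inv) ≫ (α_ _ _ _).inv ≫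
      ((α_ _ _ _).inv ≫ (β_ H (cotangent H)).hom ▷ H ≫ (α_ _ _ _).hom ≫
        cotangent H ◁ μ[H]) ▷ N := by
    have e : (f ≫ ρN) ≫ zeta H Δ[H] ▷ N =
        (zeta H ρM ≫ cotangent H ◁ f) ≫ cotangent H ◁ ρN ≫ (α_ _ _ _).inv := by
      rw [Category.assoc, hN', reassoc_of% hf, Category.assoc]
    have e' : (α_ H H N).inv ≫ (H ◁ zeta H Δ[H]) ▷ N =
        H ◁ (zeta H Δ[H] ▷ N) ≫ (α_ _ _ _).inv := by monoidal
    rw [comp_whiskerRight, reassoc_of% e', tensorHom_def', Category.assoc, ← whisker_exchange_assoc,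
      ← MonoidalCategory.whiskerLeft_comp_assoc, e, MonoidalCategory.whiskerLeft_comp]
    simp only [Category.assoc, whisker_exchange_assoc]
  rw [conjugate]
  simp only [Category.assoc]
  rw [← comp_whiskerRight, mul_zeta, MonoidalPreadditive.add_whiskerRight, Preadditive.comp_add,
    Preadditive.comp_add, Preadditive.comp_add, t1, t2, s, neg_add_cancel]

/-- If the invariants `Ker ζ_H` consist of scalars only, and tensoring with `N` preserves this
kernel, then every morphism commuting with the maps `ζ` commutes with the coactions. -/
lemma comm_coact_of_comm_zeta
    (hK : (kernel.ι (zeta H Δ[H]) ≫ ε[H]) ≫ η[H] = kernel.ι (zeta H Δ[H]))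
    [PreservesLimit (parallelPair (zeta H Δ[H]) 0) (tensorRight N)]
    (hM : ρM ≫ ε[H] ▷ M = (λ_ M).inv)
    (hM' : ρM ≫ Δ[H] ▷ M = ρM ≫ H ◁ ρM ≫ (α_ H H M).inv)
    (hN : ρN ≫ ε[H] ▷ N = (λ_ N).inv)
    (hN' : ρN ≫ Δ[H] ▷ N = ρN ≫ H ◁ ρN ≫ (α_ H H N).inv)
    (hf : f ≫ zeta H ρN = zeta H ρM ≫ cotangent H ◁ f) :
    f ≫ ρN = ρM ≫ H ◁ f := by
  -- Flatness enters here: the kernel of $\zeta_H\otimes N$ is $H^{\mathfrak g}\otimes N$.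
  obtain ⟨t, ht⟩ : ∃ t, t ≫ kernel.ι (zeta H Δ[H]) ▷ N = conjugate H ρM ρN f :=
    ⟨_, (KernelFork.mapIsLimit _ (kernelIsKernel (zeta H Δ[H])) (tensorRight N)).fac
      (KernelFork.ofι _ (conjugate_zeta H hM' hN' hf)) WalkingParallelPair.zero⟩
  -- A map into the scalars tensored with $N$ is determined by applying $\varepsilon$, which gives
  -- $f$.
  have h : conjugate H ρM ρN f = f ≫ (λ_ N).inv ≫ η[H] ▷ N := by
    rw [← Category.assoc, ← conjugate_counit H hM hN, Category.assoc, ← comp_whiskerRight, ← ht,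
      Category.assoc, ← comp_whiskerRight, ← Category.assoc, hK]
  rw [← mul_conjugate H (f := f) (ρN := ρN) hM hM', h]
  have u : H ◁ (f ≫ (λ_ N).inv ≫ η[H] ▷ N) ≫ (α_ H H N).inv ≫ μ[H] ▷ N =
      H ◁ f ≫ (ρ_ H).inv ▷ N ≫ (H ◁ η[H] ≫ μ[H]) ▷ N := by monoidal
  rw [u, MonObj.mul_one]
  monoidal

end Invariants

section Connected

variable (H : A) [BimonObj H]

/-- The invariants `Ker ζ_H` are isomorphic to the unit object if and only if they consist of
scalars. -/
lemma nonempty_kernel_zeta_iso_iff : Nonempty (kernel (zeta H Δ[H]) ≅ 𝟙_ A) ↔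
    (kernel.ι (zeta H Δ[H]) ≫ ε[H]) ≫ η[H] = kernel.ι (zeta H Δ[H]) := by
  let u : 𝟙_ A ⟶ kernel (zeta H Δ[H]) := kernel.lift _ η[H] (one_zeta H)
  have hu : u ≫ kernel.ι (zeta H Δ[H]) = η[H] := kernel.lift_ι _ _ _
  have hu' : u ≫ kernel.ι (zeta H Δ[H]) ≫ ε[H] = 𝟙 _ := by
    rw [reassoc_of% hu, BimonObj.one_counit]
  constructor
  · rintro ⟨e⟩
    have h : (u ≫ e.hom) ≫ e.inv ≫ kernel.ι (zeta H Δ[H]) ≫ ε[H] = 𝟙 _ := by simpa using hu'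
    have h' : (e.inv ≫ kernel.ι (zeta H Δ[H]) ≫ ε[H]) ≫ u ≫ e.hom = 𝟙 _ :=
      -- The unit $\mathbf 1\to H^{\mathfrak g}$ is split by $\varepsilon$; transported to
      -- $\mathrm{End}(\mathbf 1)$, which is commutative, a one-sided inverse is two-sided.
      (end_unit_comm _ _).trans h
    have h'' : (kernel.ι (zeta H Δ[H]) ≫ ε[H]) ≫ u = 𝟙 _ := by
      rw [← cancel_epi e.inv, ← cancel_mono e.hom]
      simpa using h'
    rw [← hu, ← Category.assoc, h'', Category.id_comp]
  · intro h
    refine ⟨⟨kernel.ι (zeta H Δ[H]) ≫ ε[H], u, ?_, hu'⟩⟩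
    rw [← cancel_mono (kernel.ι (zeta H Δ[H])), Category.assoc, hu, h, Category.id_comp]

end Connected
end TensorLie

/-! ### Exactness of the tensor product of ind-objects -/

noncomputable section

namespace IndTensor
open scoped MonoidalCategory.ExternalProduct
open LawfulDayConvolutionMonoidalCategoryStruct

section Kan

variable {K : Type*} [Category* K] {D : Type*} [Category* D] {E : Type*} [Category* E]
  {V : Type*} [Category* V] {L : D ⥤ E} {G : K ⥤ D ⥤ V} {T : K ⥤ E ⥤ V}

/-- A functorial family of left Kan extensions is isomorphic to the functor `L.lan`. -/
def lanIso [∀ F : D ⥤ V, L.HasLeftKanExtension F]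
    (u : G ⟶ T ⋙ (Functor.whiskeringLeft _ _ V).obj L)
    (h : ∀ k, (T.obj k).IsLeftKanExtension (u.app k)) : T ≅ G ⋙ L.lan :=
  NatIso.ofComponents (fun k => Functor.leftKanExtensionUnique (T.obj k) (u.app k)
      (L.lan.obj (G.obj k)) (L.lanUnit.app (G.obj k)))
    (fun {k k'} f => by
      apply Functor.hom_ext_of_isLeftKanExtension _ (u.app k)
      ext x
      have h1 := congr_app (u.naturality f) x
      have h2 := congr_app (L.lanUnit.naturality (G.map f)) x
      have h3 (k) := (T.obj k).descOfIsLeftKanExtension_fac_app (u.app k)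
        (L.lan.obj (G.obj k)) (L.lanUnit.app (G.obj k)) x
      dsimp [Functor.leftKanExtensionUnique, Functor.leftKanExtensionUniqueOfIso] at h1 h2 h3 ⊢
      simp only [Category.id_comp] at h3 ⊢
      rw [← reassoc_of% h1, h3, reassoc_of% h3, h2])

end Kan

variable {C : Type v} [SmallCategory C] [MonoidalCategory C]

/-- Day convolution on the left with a fixed presheaf. -/
def dayLeft (A : Cᵒᵖ ⥤ Type v) : (Cᵒᵖ ⥤ Type v) ⥤ (Cᵒᵖ ⥤ Type v) :=
  (Prod.sectR A (Cᵒᵖ ⥤ Type v) ⋙ externalProductBifunctor Cᵒᵖ Cᵒᵖ (Type v)) ⋙ (tensor Cᵒᵖ).lan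

instance (A : Cᵒᵖ ⥤ Type v) (J : Type v) [SmallCategory J] :
    PreservesColimitsOfShape J (dayLeft A) := by
  have : PreservesColimitsOfSize.{v, v} ((tensor Cᵒᵖ).lan :
      (Cᵒᵖ × Cᵒᵖ ⥤ Type v) ⥤ (Cᵒᵖ ⥤ Type v)) :=
    ((tensor Cᵒᵖ).lanAdjunction (Type v)).leftAdjoint_preservesColimits
  unfold dayLeft
  infer_instance

/-- Transfers exactness questions about $A\otimes -$ to presheaves, where they can be checked
pointwise. -/
def tensorLeftIso (A : Ind C) :
    tensorLeft A ⋙ Ind.inclusion C ≅ Ind.inclusion C ⋙ dayLeft ((Ind.inclusion C).obj A) :=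
  lanIso (K := Ind C) (L := tensor Cᵒᵖ) (T := tensorLeft A ⋙ Ind.inclusion C)
    (G := Ind.inclusion C ⋙ Prod.sectR ((Ind.inclusion C).obj A) (Cᵒᵖ ⥤ Type v) ⋙
      externalProductBifunctor Cᵒᵖ Cᵒᵖ (Type v))
    { app Z := convolutionExtensionUnit Cᵒᵖ (Type v) A Z
      naturality := fun Z Z' f => by
        ext ⟨x, y⟩ : 2
        exact (convolutionExtensionUnit_comp_ι_map_whiskerLeft_app (Type v) A f x y).symm }
    (fun Z => (isPointwiseLeftKanExtensionConvolutionExtensionUnit (C := Cᵒᵖ) (V := Type v)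
      A Z).isLeftKanExtension)

instance tensorLeft_preservesFilteredColimits (A : Ind C) (J : Type v) [SmallCategory J]
    [IsFiltered J] : PreservesColimitsOfShape J (tensorLeft A) := by
  have : PreservesColimitsOfShape J (tensorLeft A ⋙ Ind.inclusion C) :=
    preservesColimitsOfShape_of_natIso (tensorLeftIso A).symm
  exact preservesColimitsOfShape_of_reflects_of_preserves _ (Ind.inclusion C)

section LeftExtension

variable {Q : C} {B : Cᵒᵖ ⥤ Type v}

/-- The components of a left extension of an external product with a representable presheaf. -/
def leftExtensionEval (E : (tensor Cᵒᵖ).LeftExtension (yoneda.obj Q ⊠ B)) {P : C} (a : P ⟶ Q)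
    (X : C) (b : B.obj (.op X)) : E.right.obj (.op (P ⊗ X)) :=
  E.hom.app (.op P, .op X) ((a, b) : (P ⟶ Q) × _)

/-- By naturality, as in the Yoneda lemma, a left extension is determined by its values at the
identity of $Q$. -/
lemma leftExtensionEval_map (E : (tensor Cᵒᵖ).LeftExtension (yoneda.obj Q ⊠ B)) {P X X' : C}
    (a : P ⟶ Q) (f : X' ⟶ X) (b : B.obj (.op X)) :
    leftExtensionEval E a X' (B.map f.op b) =
      E.right.map (a ⊗ₘ f).op (leftExtensionEval E (𝟙 Q) X b) := by
  have := ConcreteCategory.congr_hom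
    (E.hom.naturality (X := (.op Q, .op X)) (Y := (.op P, .op X')) (Prod.mkHom a.op f.op))
    ((𝟙 Q, b) : (Q ⟶ Q) × _)
  refine Eq.trans ?_ this
  change leftExtensionEval E a X' _ = leftExtensionEval E (a ≫ 𝟙 Q) X' _
  rw [Category.comp_id]
  rfl

end LeftExtension

/-! ### Convolution with a dualizable representable presheaf -/

section Dual

variable (Q : C) [HasRightDual Q]

/-- The adjunct of a morphism `P ⟶ Q`. -/
def dualEval {P : C} (a : P ⟶ Q) (X : C) : Qᘁ ⊗ (P ⊗ X) ⟶ X :=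
  Qᘁ ◁ (a ▷ X) ≫ (α_ _ _ _).inv ≫ ε_ Q Qᘁ ▷ X ≫ (λ_ _).hom

/-- The coevaluation of `Q` tensored with `X`. -/
def dualCoeval (X : C) : X ⟶ Q ⊗ (Qᘁ ⊗ X) := (λ_ _).inv ≫ (η_ Q Qᘁ ▷ X) ≫ (α_ _ _ _).hom

lemma dualEval_naturality {P P' X X' : C} (g : P' ⟶ P) (a : P ⟶ Q) (f : X' ⟶ X) :
    dualEval Q (g ≫ a) X' ≫ f = Qᘁ ◁ (g ⊗ₘ f) ≫ dualEval Q a X := by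
  simp only [dualEval, Category.assoc, MonoidalCategory.tensorHom_def,
    MonoidalCategory.whiskerLeft_comp]
  rw [← MonoidalCategory.whiskerLeft_comp_assoc _ (P ◁ f), whisker_exchange]
  simp only [comp_whiskerRight, MonoidalCategory.whiskerLeft_comp, Category.assoc,
    ← leftUnitor_naturality, ← whisker_exchange_assoc, associator_inv_naturality_right_assoc]

lemma dualCoeval_naturality {X X' : C} (f : X' ⟶ X) :
    f ≫ dualCoeval Q X = dualCoeval Q X' ≫ Q ◁ Qᘁ ◁ f := by
  simp only [dualCoeval, Category.assoc, leftUnitor_inv_naturality_assoc, whisker_exchange_assoc]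
  simp

lemma dualCoeval_dualEval {P X : C} (a : P ⟶ Q) :
    dualCoeval Q (P ⊗ X) ≫ Q ◁ dualEval Q a X = a ▷ X := by
  have h := dualCoeval_naturality Q (a ▷ X)
  have e : dualEval Q a X = Qᘁ ◁ (a ▷ X) ≫ dualEval Q (𝟙 Q) X := by simp [dualEval]
  rw [e, MonoidalCategory.whiskerLeft_comp, ← reassoc_of% h]
  have z := ExactPairing.evaluation_coevaluation Q Qᘁ
  have : dualCoeval Q (Q ⊗ X) ≫ Q ◁ dualEval Q (𝟙 Q) X =
      (λ_ _).inv ≫ (α_ _ _ _).inv ≫ (η_ Q Qᘁ ▷ Q ≫ (α_ Q Qᘁ Q).hom ≫ Q ◁ ε_ Q Qᘁ) ▷ X ≫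
        (ρ_ Q).hom ▷ X := by
    simp only [dualCoeval, dualEval]
    monoidal
  rw [this, z]
  monoidal

lemma whiskerLeft_dualCoeval (X : C) :
    Qᘁ ◁ dualCoeval Q X ≫ dualEval Q (𝟙 Q) (Qᘁ ⊗ X) = 𝟙 _ := by
  have z := ExactPairing.coevaluation_evaluation Q Qᘁ
  have : Qᘁ ◁ dualCoeval Q X ≫ dualEval Q (𝟙 Q) (Qᘁ ⊗ X) = Qᘁ ◁ (λ_ X).inv ≫ (α_ _ _ _).inv ≫
      (Qᘁ ◁ η_ Q Qᘁ ≫ (α_ Qᘁ Q Qᘁ).inv ≫ ε_ Q Qᘁ ▷ Qᘁ) ▷ X ≫ (α_ _ _ _).hom ≫ (λ_ _).hom := by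
    simp only [dualCoeval, dualEval]
    monoidal
  rw [this, z]
  monoidal

variable (B : Cᵒᵖ ⥤ Type v)

/-- The unit exhibiting `X ↦ B (Qᘁ ⊗ X)` as the convolution of the presheaf represented by `Q` with
the presheaf `B`. -/
def yonedaDayUnit : yoneda.obj Q ⊠ B ⟶ tensor Cᵒᵖ ⋙ (tensorLeft Qᘁ).op ⋙ B where
  app p := ↾fun q => B.map (dualEval Q q.1 p.2.unop).op q.2
  naturality p q f := by
    ext ⟨a, b⟩
    change B.map _ (B.map f.2 b) = B.map _ (B.map _ b)
    rw [← Functor.map_comp_apply, ← Functor.map_comp_apply]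
    exact ConcreteCategory.congr_hom (congrArg B.map (congrArg Quiver.Hom.op
      (dualEval_naturality Q f.1.unop a f.2.unop))) b

-- Since $Q^\vee\otimes-$ is left adjoint to $Q\otimes-$, extending a presheaf along the latter is
-- precomposing with the former. The two triangle identities give the factorization and its
-- uniqueness.
instance (E : (tensor Cᵒᵖ).LeftExtension (yoneda.obj Q ⊠ B)) :
    Unique (Functor.LeftExtension.mk _ (yonedaDayUnit Q B) ⟶ E) where
  default := StructuredArrow.homMk
      { app := fun X => ↾fun a => E.right.map (dualCoeval Q X.unop).op
          (leftExtensionEval E (𝟙 Q) (Qᘁ ⊗ X.unop) a)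
        naturality := fun X X' g => by
          ext (a : B.obj (.op (Qᘁ ⊗ X.unop)))
          change E.right.map _ (leftExtensionEval E (𝟙 Q) _ (B.map (Qᘁ ◁ g.unop).op a)) =
            E.right.map g (E.right.map _ _)
          rw [leftExtensionEval_map, ← Functor.map_comp_apply, ← Functor.map_comp_apply]
          have h := dualCoeval_naturality Q g.unop
          rw [← id_tensorHom] at h
          exact ConcreteCategory.congr_hom (congrArg E.right.map (congrArg Quiver.Hom.op h.symm)) _ } (by
        ext ⟨⟨p⟩, ⟨p'⟩⟩ ⟨a, b⟩
        change E.right.map _ (leftExtensionEval E (𝟙 Q) _ (B.map (dualEval Q a p').op b)) =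
          leftExtensionEval E a p' b
        have h := dualCoeval_dualEval Q (X := p') a
        rw [← id_tensorHom, ← tensorHom_id] at h
        have hb := leftExtensionEval_map E a (𝟙 p') b
        rw [op_id, Functor.map_id_apply] at hb
        rw [leftExtensionEval_map, ← Functor.map_comp_apply, hb]
        exact ConcreteCategory.congr_hom (congrArg E.right.map (congrArg Quiver.Hom.op h)) _)
  uniq φ := by
    ext1
    ext X (a : B.obj (.op (Qᘁ ⊗ X.unop)))
    change φ.right.app X a = E.right.map _ _
    have hE : leftExtensionEval E (𝟙 Q) _ a =
        φ.right.app _ (B.map (dualEval Q (𝟙 Q) (Qᘁ ⊗ X.unop)).op a) := by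
      rw [leftExtensionEval, ← StructuredArrow.w φ]
      rfl
    refine Eq.trans ?_ (congrArg _ hE.symm)
    have h1 := ConcreteCategory.congr_hom (φ.right.naturality (dualCoeval Q X.unop).op)
      (B.map (dualEval Q (𝟙 Q) (Qᘁ ⊗ X.unop)).op a)
    refine Eq.trans ?_ h1
    have h := ConcreteCategory.congr_hom (congrArg B.map
      (congrArg Quiver.Hom.op (whiskerLeft_dualCoeval Q X.unop))) a
    rw [op_comp, op_id, Functor.map_id_apply, Functor.map_comp_apply] at h
    exact congrArg (φ.right.app X) h.symm

instance : ((tensorLeft Qᘁ).op ⋙ B).IsLeftKanExtension (yonedaDayUnit Q B) :=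
  ⟨⟨Limits.IsInitial.ofUnique _⟩⟩

/-- Convolution with the presheaf represented by `Q` is the functor `B ↦ B (Qᘁ ⊗ -)`. -/
def dayLeftYonedaIso :
    (Functor.whiskeringLeft _ _ (Type v)).obj (tensorLeft Qᘁ).op ≅ dayLeft (yoneda.obj Q) :=
  lanIso (K := Cᵒᵖ ⥤ Type v) (L := tensor Cᵒᵖ)
    (T := (Functor.whiskeringLeft _ _ (Type v)).obj (tensorLeft Qᘁ).op)
    (G := Prod.sectR (yoneda.obj Q) (Cᵒᵖ ⥤ Type v) ⋙
      externalProductBifunctor Cᵒᵖ Cᵒᵖ (Type v))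
    { app B := yonedaDayUnit Q B
      naturality := fun B B' f => by
        ext ⟨x, y⟩ ⟨a, b⟩
        exact ConcreteCategory.congr_hom (f.naturality (dualEval Q a y.unop).op).symm b }
    (fun B => (inferInstance : ((tensorLeft Qᘁ).op ⋙ B).IsLeftKanExtension (yonedaDayUnit Q B)))

end Dual

end IndTensor

end

noncomputable section

namespace IndTensor

variable {C : Type v} [SmallCategory C] [MonoidalCategory C]

/-- Isomorphic objects give isomorphic sections of a product category. -/
def sectRIso {D : Type*} [Category* D] {E : Type*} [Category* E] {X X' : D} (e : X ≅ X') :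
    Prod.sectR X E ≅ Prod.sectR X' E :=
  NatIso.ofComponents (fun B => Iso.prod e (Iso.refl B)) (fun f => by
    ext
    · exact (Category.id_comp _).trans (Category.comp_id _).symm
    · exact (Category.comp_id _).trans (Category.id_comp _).symm)

/-! ### Flatness of every ind-object -/

section Flat

variable [HasFiniteLimits C]

/-- On presheaves this functor is precomposition with $Q^\vee\otimes-$, which preserves limits. -/
instance tensorLeft_yoneda_preservesFiniteLimits (Q : C) [HasRightDual Q] :
    PreservesFiniteLimits (tensorLeft (Ind.yoneda.obj Q)) := by
  let e : tensorLeft (Ind.yoneda.obj Q) ⋙ Ind.inclusion C ≅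
      Ind.inclusion C ⋙ (Functor.whiskeringLeft _ _ (Type v)).obj (tensorLeft Qᘁ).op :=
    tensorLeftIso (Ind.yoneda.obj Q) ≪≫ Functor.isoWhiskerLeft _
      (Functor.isoWhiskerRight (Functor.isoWhiskerRight (sectRIso
        (Ind.yonedaCompInclusion.app Q)) _) _ ≪≫ (dayLeftYonedaIso Q).symm)
  have : PreservesFiniteLimits (tensorLeft (Ind.yoneda.obj Q) ⋙ Ind.inclusion C) :=
    preservesFiniteLimits_of_natIso e.symm
  exact preservesFiniteLimits_of_reflects_of_preserves _ (Ind.inclusion C)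

variable [SymmetricCategory C]

instance tensorRight_yoneda_preservesFiniteLimits (Q : C) [HasRightDual Q] :
    PreservesFiniteLimits (tensorRight (Ind.yoneda.obj Q)) :=
  preservesFiniteLimits_of_natIso (BraidedCategory.tensorLeftIsoTensorRight _)

/-- Tensoring with an ind-object is a filtered colimit of the functors of tensoring with objects
of `C`. -/
def tensorRightIsoColim (Z : Ind C) :
    (curriedTensor (Ind C) ⋙ (Functor.whiskeringLeft _ _ _).obj
      (Z.presentation.F ⋙ Ind.yoneda)) ⋙ colim ≅ tensorRight Z :=
  NatIso.ofComponents (fun A => (preservesColimitIso (tensorLeft A)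
    (Z.presentation.F ⋙ Ind.yoneda)).symm ≪≫
      (tensorLeft A).mapIso Z.colimitPresentationCompYoneda) (by
    intro A B f
    dsimp
    apply colimit.hom_ext
    intro j
    simp only [curriedTensor_obj_obj, ι_colimMap_assoc, Functor.whiskerLeft_app, ι_preservesColimitIso_inv_assoc,
      Functor.comp_obj, Category.assoc]
    simp [whisker_exchange, whisker_exchange_assoc])

/-- A filtered colimit of left exact functors is left exact, because filtered colimits in
$\mathrm{Ind}\,\mathcal C$ commute with finite limits. -/
instance tensorRight_preservesFiniteLimits [RightRigidCategory C] (Z : Ind C) :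
    PreservesFiniteLimits (tensorRight Z) := by
  have h (j : Z.presentation.I) : PreservesFiniteLimits ((curriedTensor (Ind C) ⋙ (Functor.whiskeringLeft _ _ _).obj
      (Z.presentation.F ⋙ Ind.yoneda)) ⋙ (evaluation _ _).obj j) :=
    inferInstanceAs (PreservesFiniteLimits (tensorRight (Ind.yoneda.obj (Z.presentation.F.obj j))))
  have : PreservesFiniteLimits (curriedTensor (Ind C) ⋙ (Functor.whiskeringLeft _ _ _).obj
      (Z.presentation.F ⋙ Ind.yoneda)) :=
    preservesFiniteLimits_of_evaluation _ h
  exact preservesFiniteLimits_of_natIso (tensorRightIsoColim Z)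

instance tensorLeft_preservesFiniteLimits [RightRigidCategory C] (Z : Ind C) :
    PreservesFiniteLimits (tensorLeft Z) :=
  preservesFiniteLimits_of_natIso (BraidedCategory.tensorLeftIsoTensorRight _).symm

end Flat

/-- A morphism from an object of `C` to `A ⊗ B` factors through `A ⊗ W` for some `W` in `C`
mapping to `B`. -/
lemma exists_factor_tensor (A B : Ind C) {X : C} (x : Ind.yoneda.obj X ⟶ A ⊗ B) :
    ∃ (W : C) (w : Ind.yoneda.obj W ⟶ B) (x' : Ind.yoneda.obj X ⟶ A ⊗ Ind.yoneda.obj W),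
      x = x' ≫ A ◁ w := by
  let F := B.presentation.F ⋙ Ind.yoneda
  obtain ⟨j, y, hy⟩ := Types.jointly_surjective _ (isColimitOfPreserves
    (tensorLeft A ⋙ Ind.inclusion C ⋙ (evaluation _ _).obj (.op X)) (colimit.isColimit F))
      (homElt _ _ (x ≫ A ◁ B.colimitPresentationCompYoneda.inv))
  obtain ⟨x', rfl⟩ := (homElt X (A ⊗ F.obj j)).surjective y
  refine ⟨_, colimit.ι F j ≫ B.colimitPresentationCompYoneda.hom, x', ?_⟩
  have h := (homElt_comp x' (A ◁ colimit.ι F j)).trans hy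
  replace h := (homElt _ _).injective h
  rw [MonoidalCategory.whiskerLeft_comp, reassoc_of% h]
  simp

end IndTensor

end

noncomputable section

namespace IndTensor

/-! ### Full faithfulness of a functor and of its ind-extension -/

section IndMap

variable {C : Type v} [SmallCategory C] {C' : Type v} [SmallCategory C'] (F : C ⥤ C')

/-- The functor `indMap F` extends `F`. -/
def yonedaIndMapIso : Ind.yoneda ⋙ indMap F ≅ F ⋙ Ind.yoneda :=
  Functor.fullyFaithfulCancelRight (Ind.inclusion C') <|
    calc (Ind.yoneda ⋙ indMap F) ⋙ Ind.inclusion C'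
      _ ≅ (Ind.yoneda ⋙ Ind.inclusion C) ⋙ F.op.lan :=
        Functor.isoWhiskerLeft (Ind.yoneda ⋙ ObjectProperty.lift _ (Ind.inclusion C ⋙ F.op.lan)
            (fun X => isIndObject_lan_op F X.isIndObject_inclusion_obj))
          (Functor.isoWhiskerRight (Ind.equivalence C').counitIso (ObjectProperty.ι _))
      _ ≅ yoneda ⋙ F.op.lan := Functor.isoWhiskerRight Ind.yonedaCompInclusion _
      _ ≅ F ⋙ yoneda := (lanIso (K := C) (L := F.op) (G := yoneda) (T := F ⋙ yoneda)
        { app := yonedaMap F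
          naturality := fun X Y f => by ext Z g; simp [yonedaMap] } 
        (fun X => (inferInstance : (yoneda.obj (F.obj X)).IsLeftKanExtension (yonedaMap F X)))).symm
      _ ≅ (F ⋙ Ind.yoneda) ⋙ Ind.inclusion C' :=
        Functor.isoWhiskerLeft F Ind.yonedaCompInclusion.symm

/-- Restriction to $\mathcal C$ gives one direction; for the other, left Kan extension along a fully
faithful functor has invertible unit. -/
lemma indMap_fullyFaithful_iff :
    (indMap F).Full ∧ (indMap F).Faithful ↔ F.Full ∧ F.Faithful := by
  constructor
  · rintro ⟨_, _⟩
    have : (F ⋙ Ind.yoneda).Faithful := Functor.Faithful.of_iso (yonedaIndMapIso F)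
    have : (F ⋙ Ind.yoneda).Full := Functor.Full.of_iso (yonedaIndMapIso F)
    exact ⟨Functor.Full.of_comp_faithful F Ind.yoneda, Functor.Faithful.of_comp F Ind.yoneda⟩
  · rintro ⟨_, _⟩
    have h := (F.op.lanAdjunction (Type v)).fullyFaithfulLOfIsIsoUnit
    have := h.full
    have := h.faithful
    unfold indMap
    exact ⟨inferInstance, inferInstance⟩

end IndMap

end IndTensor

end

/-! ### Ind-objects of finite length -/

namespace IndTensor

variable {C : Type v} [SmallCategory C]

lemma ind_hom_ext {S T : Ind C} {f g : S ⟶ T}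
    (h : ∀ (B : C) (b : Ind.yoneda.obj B ⟶ S), b ≫ f = b ≫ g) : f = g := by
  rw [← cancel_epi S.colimitPresentationCompYoneda.hom]
  apply colimit.hom_ext
  intro j
  rw [← Category.assoc, ← Category.assoc]
  exact h _ _

variable [Abelian C]

/-- Subobjects in `Ind C` of noetherian objects of `C` are objects of `C`. -/
lemma nonempty_yoneda_iso_of_mono {X : C} [IsNoetherianObject X] {S : Ind C}
    (i : S ⟶ Ind.yoneda.obj X) [Mono i] : ∃ T : C, Nonempty (Ind.yoneda.obj T ≅ S) := by
  -- Choose an object of $\mathcal C$ mapping to $S$ whose image in $X$ is maximal; this image will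
  -- be $S$.
  let P : Set (Subobject X) := {U | ∃ (A : C) (a : Ind.yoneda.obj A ⟶ S) (f : A ⟶ X),
    a ≫ i = Ind.yoneda.map f ∧ U = imageSubobject f}
  have hP : P.Nonempty := ⟨_, X, 0, 0, by simp, rfl⟩
  obtain ⟨_, ⟨A, a, f, hf, rfl⟩, hmax⟩ :=
    (wellFounded_gt (α := Subobject X)).has_min P hP
  have sq : CommSq a (Ind.yoneda.map (factorThruImageSubobject f)) i
      (Ind.yoneda.map (imageSubobject f).arrow) :=
    ⟨by rw [hf, ← Functor.map_comp, imageSubobject_arrow_comp]⟩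
  have := strongEpi_of_epi (Ind.yoneda.map (factorThruImageSubobject f))
  have hl := sq.fac_right
  have : Mono sq.lift := by
    have : Mono (sq.lift ≫ i) := by rw [hl]; infer_instance
    exact mono_of_mono sq.lift i
  -- Any other $b:B\to S$ and $a$ factor through a common object of $\mathcal C$ over $S$. By
  -- maximality its image in $X$ is no larger, so $b$ factors through `sq.lift`.
  have : Epi sq.lift := by
    refine Preadditive.epi_of_cancel_zero _ fun {Z} g hg => ind_hom_ext fun B b => ?_
    have : IsFiltered (CostructuredArrow Ind.yoneda S) := RepresentablyCoflat.filtered S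
    let F : CostructuredArrow Ind.yoneda S := .mk a
    let G : CostructuredArrow Ind.yoneda S := .mk b
    obtain ⟨k, hk⟩ := Ind.yoneda.map_surjective ((IsFiltered.max F G).hom ≫ i)
    have ha : Ind.yoneda.map (IsFiltered.leftToMax F G).left ≫ (IsFiltered.max F G).hom = a :=
      CostructuredArrow.w (IsFiltered.leftToMax F G)
    have hb : Ind.yoneda.map (IsFiltered.rightToMax F G).left ≫ (IsFiltered.max F G).hom = b :=
      CostructuredArrow.w (IsFiltered.rightToMax F G)
    have hfk : (IsFiltered.leftToMax F G).left ≫ k = f := by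
      apply Ind.yoneda.map_injective
      rw [Functor.map_comp, hk, ← hf, reassoc_of% ha]
    have hle : imageSubobject f ≤ imageSubobject k := by
      rw [← hfk]
      exact imageSubobject_comp_le _ _
    have heq : imageSubobject f = imageSubobject k :=
      eq_of_le_of_not_lt hle (hmax _ ⟨_, _, k, hk.symm, rfl⟩)
    obtain ⟨r, hr⟩ : ∃ r, r ≫ (imageSubobject f).arrow = k := by
      rw [heq]
      exact ⟨_, imageSubobject_arrow_comp k⟩
    have hd : (IsFiltered.max F G).hom = Ind.yoneda.map r ≫ sq.lift := by
      rw [← cancel_mono i, Category.assoc, hl, ← Functor.map_comp, hr, hk]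
    rw [← hb, hd]
    simp [hg]
  exact ⟨_, ⟨@asIso _ _ _ _ sq.lift (isIso_of_mono_of_epi _)⟩⟩

/-- Quotients in `Ind C` of noetherian objects of `C` are objects of `C`. -/
lemma nonempty_yoneda_iso_of_epi {X : C} [IsNoetherianObject X] {S : Ind C}
    (p : Ind.yoneda.obj X ⟶ S) [Epi p] : ∃ T : C, Nonempty (Ind.yoneda.obj T ≅ S) := by
  obtain ⟨W, ⟨e⟩⟩ := nonempty_yoneda_iso_of_mono (kernel.ι p)
  obtain ⟨g, hg⟩ := Ind.yoneda.map_surjective (e.hom ≫ kernel.ι p)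
  exact ⟨cokernel g, ⟨PreservesCokernel.iso Ind.yoneda g ≪≫ cokernelIsoOfEq hg ≪≫
    cokernelEpiComp e.hom (kernel.ι p) ≪≫ (cokernelIsCokernel _).coconePointUniqueUpToIso
      (Abelian.epiIsCokernelOfKernel _ (kernelIsKernel p))⟩⟩

end IndTensor

/-! ### Local finiteness of comodules -/

namespace TensorLie
open scoped MonObj ComonObj HopfObj
open IndTensor

section Subcomodule

variable {A : Type u} [Category.{v} A] [MonoidalCategory A] (H : A)

lemma counit_coact_of_mono [ComonObj H] {M V : A} {ρ : M ⟶ H ⊗ M}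
    (hM : ρ ≫ ε[H] ▷ M = (λ_ M).inv) {c : V ⟶ H ⊗ V} (j : V ⟶ M) [Mono (𝟙_ A ◁ j)]
    (hj : j ≫ ρ = c ≫ H ◁ j) : c ≫ ε[H] ▷ V = (λ_ V).inv := by
  rw [← cancel_mono (𝟙_ A ◁ j), Category.assoc, ← whisker_exchange, ← reassoc_of% hj, hM,
    leftUnitor_inv_naturality]

lemma coassoc_of_mono [ComonObj H] {M V : A} {ρ : M ⟶ H ⊗ M}
    (hM : ρ ≫ Δ[H] ▷ M = ρ ≫ H ◁ ρ ≫ (α_ H H M).inv) {c : V ⟶ H ⊗ V} (j : V ⟶ M)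
    [Mono ((H ⊗ H) ◁ j)] (hj : j ≫ ρ = c ≫ H ◁ j) :
    c ≫ Δ[H] ▷ V = c ≫ H ◁ c ≫ (α_ H H V).inv := by
  rw [← cancel_mono ((H ⊗ H) ◁ j), Category.assoc, ← whisker_exchange, ← reassoc_of% hj, hM,
    reassoc_of% hj, ← MonoidalCategory.whiskerLeft_comp_assoc, hj]
  simp

end Subcomodule

section Finite

variable {C : Type v} [SmallCategory C] [Abelian C] [MonoidalCategory C] [SymmetricCategory C]
  [RightRigidCategory C] [∀ X : C, IsNoetherianObject X]

instance mono_whiskerLeft (Z : Ind C) {X Y : Ind C} (f : X ⟶ Y) [Mono f] : Mono (Z ◁ f) :=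
  inferInstanceAs (Mono ((tensorLeft Z).map f))

/-- A morphism from an object of `C` to a comodule in `Ind C` factors through a subcomodule
in `C`. -/
lemma exists_comod_factor {H : Ind C} [ComonObj H] {M : Ind C} {ρ : M ⟶ H ⊗ M}
    (hM : ρ ≫ ε[H] ▷ M = (λ_ M).inv) (hM' : ρ ≫ Δ[H] ▷ M = ρ ≫ H ◁ ρ ≫ (α_ H H M).inv)
    {X : C} (x : Ind.yoneda.obj X ⟶ M) :
    ∃ (V : Comod (Ind.yoneda (C := C)) H) (j : Ind.yoneda.obj V.X ⟶ M) (t : X ⟶ V.X),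
      Mono j ∧ j ≫ ρ = V.coact ≫ H ◁ j ∧ Ind.yoneda.map t ≫ j = x := by
  obtain ⟨W, w, x', hx⟩ := exists_factor_tensor H M (x ≫ ρ)
  let i := Abelian.image.ι w
  have hi : Abelian.factorThruImage w ≫ i = w := Abelian.image.fac w
  -- Replace $W$ by its image in $M$. The subcomodule sought is $V=\rho^{-1}(H\otimes
  -- \mathrm{Im}\,w)$.
  obtain ⟨I, ⟨eI⟩⟩ := nonempty_yoneda_iso_of_epi (Abelian.factorThruImage w)
  have sq := IsPullback.of_hasPullback ρ (H ◁ i)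
  let V := pullback ρ (H ◁ i)
  let j : V ⟶ M := pullback.fst _ _
  -- The counit axiom puts $V$ inside the image of $w$, so $V$ is an object of $\mathcal C$.
  have hs : (pullback.snd ρ (H ◁ i) ≫ ε[H] ▷ _ ≫ (λ_ _).hom) ≫ i = j := by
    simp only [Category.assoc, ← leftUnitor_naturality, ← whisker_exchange_assoc, ← sq.w_assoc,
      reassoc_of% hM]
    simp [j]
  have hmono : Mono ((pullback.snd ρ (H ◁ i) ≫ ε[H] ▷ _ ≫ (λ_ _).hom) ≫ eI.inv) := by
    have : Mono ((pullback.snd ρ (H ◁ i) ≫ ε[H] ▷ _ ≫ (λ_ _).hom) ≫ i) := by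
      rw [hs]; infer_instance
    have := mono_of_mono (pullback.snd ρ (H ◁ i) ≫ ε[H] ▷ _ ≫ (λ_ _).hom) i
    infer_instance
  obtain ⟨V₀, ⟨e⟩⟩ := nonempty_yoneda_iso_of_mono
    ((pullback.snd ρ (H ◁ i) ≫ ε[H] ▷ _ ≫ (λ_ _).hom) ≫ eI.inv)
  -- Exactness makes $H\otimes V$ a pullback again; coassociativity shows that $\rho$ maps $V$ into
  -- it.
  obtain ⟨c, hc⟩ : ∃ c : V ⟶ H ⊗ V, c ≫ H ◁ j = j ≫ ρ := by
    refine ⟨(sq.map (tensorLeft H)).lift (j ≫ ρ) (pullback.snd _ _ ≫ Δ[H] ▷ _ ≫ (α_ _ _ _).hom) ?_,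
      (sq.map (tensorLeft H)).lift_fst _ _ _⟩
    have h1 : (pullback.snd ρ (H ◁ i) ≫ Δ[H] ▷ _ ≫ (α_ _ _ _).hom) ≫ H ◁ H ◁ i =
        (pullback.snd ρ (H ◁ i) ≫ H ◁ i) ≫ Δ[H] ▷ _ ≫ (α_ _ _ _).hom := by
      simp only [Category.assoc, whisker_exchange_assoc]
      simp
    refine Eq.trans ?_ h1.symm
    rw [← sq.w, Category.assoc, Category.assoc, reassoc_of% hM']
    simp [j]
  have hj : (e.hom ≫ j) ≫ ρ = (e.hom ≫ c ≫ H ◁ e.inv) ≫ H ◁ (e.hom ≫ j) := by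
    simp [hc]
  obtain ⟨t, ht⟩ := Ind.yoneda.map_surjective
    (sq.lift x (x' ≫ H ◁ Abelian.factorThruImage w) (by
      rw [hx, Category.assoc, ← MonoidalCategory.whiskerLeft_comp, hi]) ≫ e.inv)
  refine ⟨⟨V₀, e.hom ≫ c ≫ H ◁ e.inv, counit_coact_of_mono H hM (e.hom ≫ j) hj,
    coassoc_of_mono H hM' (e.hom ≫ j) hj⟩, e.hom ≫ j, t, inferInstance, hj, ?_⟩
  rw [ht]
  simp [j]

end Finite

/-! ### Connectedness and the derivative functor -/

section Trivial

variable {A : Type u} [Category.{v} A] [MonoidalCategory A] [SymmetricCategory A]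
  {𝒞 : Type w} [Category.{v} 𝒞] (y : 𝒞 ⥤ A) (H : A) [BimonObj H]

/-- An object with the trivial coaction. -/
@[simps]
noncomputable def trivialComod (X : 𝒞) : Comod y H where
  X := X
  coact := (λ_ (y.obj X)).inv ≫ η[H] ▷ y.obj X
  counit_coact := by simp [← comp_whiskerRight]
  coassoc := by
    have h : η[H] ≫ Δ[H] = (λ_ (𝟙_ A)).inv ≫ (η[H] ⊗ₘ η[H]) := BimonObj.one_comul H
    rw [Category.assoc, ← comp_whiskerRight, h, MonoidalCategory.tensorHom_def]
    monoidal

/-- Apply $\mathrm{id}\otimes\varepsilon$ to $\Delta x=1\otimes x$. -/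
lemma eq_counit_unit_of_invariant {H} [BimonObj H] {X : A} (x : X ⟶ H)
    (h : x ≫ Δ[H] = ((λ_ X).inv ≫ η[H] ▷ X) ≫ H ◁ x) : (x ≫ ε[H]) ≫ η[H] = x := by
  have h' := h =≫ (H ◁ ε[H] ≫ (ρ_ H).hom)
  have e : (λ_ X).inv ≫ η[H] ▷ X ≫ H ◁ x ≫ H ◁ ε[H] ≫ (ρ_ H).hom = x ≫ ε[H] ≫ η[H] := by
    rw [← MonoidalCategory.whiskerLeft_comp_assoc, ← whisker_exchange_assoc, rightUnitor_naturality,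
      ← leftUnitor_inv_naturality_assoc, ← unitors_equal]
    simp
  simp only [Category.assoc, e, ComonObj.comul_counit_assoc, Iso.inv_hom_id, Category.comp_id] at h'
  rw [Category.assoc, ← h']

variable [Abelian A] [MonoidalPreadditive A]

lemma zeta_unit (X : A) : zeta H ((λ_ X).inv ≫ η[H] ▷ X) = 0 := by
  rw [zeta, Category.assoc, ← comp_whiskerRight, one_toCotangent]
  simp

instance : (derivative y H).Faithful where
  map_injective h := Comod.Hom.ext (congrArg LieMod.Hom.hom h)

end Trivial

/-! ### Fullness of the derivative functor and scalar invariants -/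

section Main

variable {A : Type u} [Category.{v} A] [MonoidalCategory A] [SymmetricCategory A]
  {𝒞 : Type w} [Category.{v} 𝒞] (y : 𝒞 ⥤ A) (H : A) [HopfObj H] [Abelian A]
  [MonoidalPreadditive A]

lemma derivative_full [∀ N : A, PreservesFiniteLimits (tensorRight N)]
    (hH : Nonempty (kernel (zeta H Δ[H]) ≅ 𝟙_ A)) : (derivative y H).Full where
  map_surjective {M N} f :=
    ⟨⟨f.hom, comm_coact_of_comm_zeta H ((nonempty_kernel_zeta_iso_iff H).1 hH) M.counit_coact
      M.coassoc N.counit_coact N.coassoc f.comm⟩, rfl⟩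

/-- Morphisms from trivial comodules to the regular comodule that are invariant under the Lie
algebra are scalar, as soon as they factor through a comodule to which fullness of the derivative
functor applies. -/
lemma eq_counit_unit_of_full [(derivative y H).Full] {X : 𝒞} (V : Comod y H)
    (j : y.obj V.X ⟶ H) [Mono (cotangent H ◁ j)] (hj : j ≫ Δ[H] = V.coact ≫ H ◁ j) (t : X ⟶ V.X)
    (ht : (y.map t ≫ j) ≫ zeta H Δ[H] = 0) :
    ((y.map t ≫ j) ≫ ε[H]) ≫ η[H] = y.map t ≫ j := by
  have h : y.map t ≫ zeta H V.coact = 0 := by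
    rw [← cancel_mono (cotangent H ◁ j), zero_comp, ← ht, zeta, zeta_comul]
    simp only [Category.assoc, ← whisker_exchange, reassoc_of% hj]
  have h' : zeta H ((λ_ (y.obj X)).inv ≫ η[H] ▷ y.obj X) ≫ cotangent H ◁ y.map t = 0 := by
    rw [zeta_unit, zero_comp]
  -- By `h`, $t$ is a $\mathfrak g$-morphism from the trivial module, so fullness makes it a
  -- comodule morphism.
  obtain ⟨g, hg⟩ := (derivative y H).map_surjective
    (X := trivialComod y H X) (Y := V) ⟨t, h.trans h'.symm⟩
  have hg' : g.hom = t := congrArg LieMod.Hom.hom hg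
  have hc : y.map t ≫ V.coact = ((λ_ (y.obj X)).inv ≫ η[H] ▷ y.obj X) ≫ H ◁ y.map t :=
    hg' ▸ g.comm
  apply eq_counit_unit_of_invariant
  rw [Category.assoc, hj, reassoc_of% hc]
  simp

lemma nonempty_kernel_zeta_iso_of_full [(derivative (𝟭 A) H).Full] :
    Nonempty (kernel (zeta H Δ[H]) ≅ 𝟙_ A) := by
  rw [nonempty_kernel_zeta_iso_iff]
  have : Mono (cotangent H ◁ 𝟙 H) := by
    rw [MonoidalCategory.whiskerLeft_id]; infer_instance
  have h := eq_counit_unit_of_full (𝟭 A) H (X := kernel (zeta H Δ[H]))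
    ⟨H, Δ[H], ComonObj.counit_comul H, ComonObj.comul_assoc_flip H⟩ (𝟙 H)
      (by simp) (kernel.ι (zeta H Δ[H])) (by simp)
  simpa using h

end Main

section Ind

variable {C : Type v} [SmallCategory C] [Abelian C] [MonoidalCategory C] [SymmetricCategory C]
  [MonoidalPreadditive C] [RightRigidCategory C] [∀ X : C, IsNoetherianObject X]

lemma nonempty_kernel_zeta_iso_of_rep_full (H : Ind C) [HopfObj H]
    [(derivative (Ind.yoneda (C := C)) H).Full] :
    Nonempty (kernel (zeta H Δ[H]) ≅ 𝟙_ (Ind C)) := by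
  rw [nonempty_kernel_zeta_iso_iff]
  -- $H^{\mathfrak g}$ need not be known to lie in $\mathcal C$, so equality is tested on objects of
  -- $\mathcal C$ mapping to it.
  refine ind_hom_ext fun X k => ?_
  obtain ⟨V, j, t, _, hj, ht⟩ := exists_comod_factor (ComonObj.counit_comul H)
    (ComonObj.comul_assoc_flip H) (k ≫ kernel.ι (zeta H Δ[H]))
  have h := eq_counit_unit_of_full _ H V j hj t (by simp [ht])
  simpa [ht] using h

end Ind

end TensorLie

theorem mainTheorem3 {C : Type v} [SmallCategory C] [Abelian C] [Linear ℂ C]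
    [MonoidalCategory C] [SymmetricCategory C] [RigidCategory C] [SymmetricTensorCategory C]
    (H : Ind C) [HopfObj H] [IsCommMonObj H] :
    (IsConnectedGroup H ↔ (indDerivative H).Full ∧ (indDerivative H).Faithful) ∧
    (IsConnectedGroup H ↔ (locAlgDerivative H).Full ∧ (locAlgDerivative H).Faithful) := by
  have (X : C) : IsNoetherianObject X := SymmetricTensorCategory.noetherian X
  rw [indDerivative, IndTensor.indMap_fullyFaithful_iff, locAlgDerivative, IsConnectedGroup]
  refine ⟨⟨fun h => ⟨derivative_full _ _ h, inferInstance⟩, fun ⟨_, _⟩ => ?_⟩,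
    ⟨fun h => ⟨derivative_full _ _ h, inferInstance⟩, fun ⟨_, _⟩ => ?_⟩⟩
  · exact nonempty_kernel_zeta_iso_of_rep_full H
  · exact nonempty_kernel_zeta_iso_of_full H
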